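/- Let $G:\mathbb R\to\mathbb R$ be a stationary Gaussian random field of mean zero on a probability space, with covariance function $\mathcal C:\mathbb R\to\mathbb R$, i.e. $\mathbb E[G(x)G(y)]=\mathcal C(x-y)$ for all $x,y\in\mathbb R$. Assume that $\mathcal C$ is Hölder continuous at zero (there are $\alpha,\delta>0$ and $K<\infty$ with $|\mathcal C(x)-\mathcal C(0)|\le K|x|^\alpha$ for $|x|<\delta$) and that there are $\beta>0$ and $K'<\infty$ with $|\mathcal C(x)|\le K'(1+|x|)^{-\beta}$ for all $x\in\mathbb R$. Then $G$ has a modification with almost surely continuous realizations; let $G$ from now on denote any such modification, and set $a(x):=\exp(G(x))$ and $\bar a:=\exp(-\tfrac12\mathcal C(0))>0$. Let $f\in C^1([0,1])$ be deterministic. Then the problem $$(\bar a\,\bar u'(x))'=f'(x)\ \text{ on }(0,1),\qquad \bar u(0)=\bar u(1)=0,$$ has a unique solution $\bar u\in C^1([0,1])$; almost surely, for every $\varepsilon>0$ the problem $$\big(a(\tfrac x\varepsilon)\,u_\varepsilon'(x)\big)'=f'(x)\ \text{ on }(0,1),\qquad u_\varepsilon(0)=u_\varepsilon(1)=0,$$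 has a unique solution $u_\varepsilon\in C^1([0,1])$; and almost surely, for all $x\in[0,1]$, $$\lim_{\varepsilon\downarrow0}\Big(u_\varepsilon'(x)-\bar u'(x)\,\frac{\bar a}{a(\frac x\varepsilon)}\Big)=0 ,$$ where derivatives at $x=0$ and $x=1$ are one-sided. -/

import Mathlib

open MeasureTheory ProbabilityTheory Filter Topology Set

/-- `G` is a stationary Gaussian random field on `ℝ` of mean zero whose covariance function
is `C`, that is, `𝔼[G(x) G(y)] = C (x - y)`. -/
structure IsStationaryGaussianField {Ω : Type*} [MeasurableSpace Ω] (G : ℝ → Ω → ℝ)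
    (C : ℝ → ℝ) (P : Measure Ω) : Prop where
  gaussian : IsGaussianProcess G P
  mean_zero : ∀ x, ∫ ω, G x ω ∂P = 0
  covariance : ∀ x y, ∫ ω, G x ω * G y ω ∂P = C (x - y)

/-- `C` is Hölder continuous at the point zero, for some positive exponent. -/
def HolderAtZero (C : ℝ → ℝ) : Prop :=
  ∃ α : ℝ, 0 < α ∧ ∃ K δ : ℝ, 0 < δ ∧ ∀ x : ℝ, |x| < δ → |C x - C 0| ≤ K * |x| ^ α

/-- Algebraic decay `|C x| ≲ (1 + |x|) ^ (-β)`. -/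
def DecaysWithRate (C : ℝ → ℝ) (β : ℝ) : Prop :=
  ∃ K : ℝ, ∀ x : ℝ, |C x| ≤ K * (1 + |x|) ^ (-β)

/-- `H` is a modification of the field `G` with almost surely continuous realizations. -/
structure IsContinuousModification {Ω : Type*} [MeasurableSpace Ω] (H G : ℝ → Ω → ℝ)
    (P : Measure Ω) : Prop where
  modification : ∀ x, H x =ᵐ[P] G x
  continuous : ∀ᵐ ω ∂P, Continuous (fun x => H x ω)

/-- `u ∈ C¹([0,1])` solves `(A u')' = f'` on `(0,1)` with `u 0 = 0` and `u 1 = 0`.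
The derivative `u'` is one-sided at the two endpoints. -/
structure IsSolution (A f u : ℝ → ℝ) : Prop where
  contDiffOn : ContDiffOn ℝ 1 u (Icc 0 1)
  equation : ∀ x ∈ Ioo (0 : ℝ) 1,
    HasDerivAt (fun y => A y * derivWithin u (Icc 0 1) y) (deriv f x) x
  left : u 0 = 0
  right : u 1 = 0

/-- The Dirichlet problem for `(A u')' = f'` on `(0,1)` has exactly one solution
(as a function on `[0,1]`). -/
def WellPosed (A f : ℝ → ℝ) : Prop :=
  ∃ u, IsSolution A f u ∧ ∀ v, IsSolution A f v → EqOn v u (Icc 0 1)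

/-! In one dimension the equation integrates once: `A u' = f + c`, and the boundary conditions force
`c = -(∫ f/A) / ∫ 1/A`. For constant `A` this is `-∫ f`. Since `1/A` is `exp (-G (x/ε))` in the
random problem, the terms with `f x` cancel and the quantity to be estimated is exactly `(c_ε + ∫ f)
* exp (-G (x/ε))`. Only averages of `exp (-G)` enter `c_ε`, and their mean `exp (C 0 / 2)` is the
reciprocal of the effective coefficient.

The factor `exp (-G (x/ε))` is unbounded as `ε → 0`, so convergence of `c_ε` alone is not enough. A
rate `ε ^ γ` for the flux constant (`exists_abs_fluxConstant_sub_le`) is played against growth of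
`exp (-G)` of order at most `γ / 2` (`ae_exp_neg_le`), leaving `ε ^ (γ / 2)`. Both bounds hold on
one event that does not depend on the point `x`.

The rate comes from a quantitative law of large numbers (`ae_abs_integral_le`). The covariance of
`exp (-G)` is dominated by `|C|`, so the variance of its integral over `[0, N]` is smaller than `N ^
2` by a power. This gives almost sure bounds along a polynomial sequence of times, and positivity of
`exp (-G)` fills the gaps. Integration by parts then handles the `C¹` weight `f`.

Growth and the continuous modification both come from Kolmogorov chaining: Hölder continuity of `C`
at zero makes high moments of increments small, and `ae_dyadicIncrementBound` controls all dyadic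
increments on the whole line, with a prefactor polynomial in space. -/

/-! ### Gaussian moments and the covariance of the exponentiated field -/

section Gaussian

variable {Ω : Type*} [MeasurableSpace Ω] {P : Measure Ω} {G : ℝ → Ω → ℝ} {C : ℝ → ℝ}

/-- The law of a centred real Gaussian variable is determined by its second moment. -/
lemma map_eq_gaussianReal_of_centered {X : Ω → ℝ} (hX : HasGaussianLaw X P)
    (h0 : ∫ ω, X ω ∂P = 0) :
    P.map X = gaussianReal 0 (∫ ω, X ω ^ 2 ∂P).toNNReal := by
  rw [hX.map_eq_gaussianReal, h0, variance_of_integral_eq_zero hX.aemeasurable h0]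

lemma gaussian_exp_moment {X : Ω → ℝ} (hX : HasGaussianLaw X P) (h0 : ∫ ω, X ω ∂P = 0) (t : ℝ) :
    Integrable (fun ω => Real.exp (t * X ω)) P ∧
      ∫ ω, Real.exp (t * X ω) ∂P = Real.exp ((∫ ω, X ω ^ 2 ∂P) * t ^ 2 / 2) := by
  have hmap := map_eq_gaussianReal_of_centered hX h0
  constructor
  · have h := integrable_exp_mul_gaussianReal (μ := 0) (v := (∫ ω, X ω ^ 2 ∂P).toNNReal) t
    rw [← hmap] at h
    exact h.comp_aemeasurable hX.aemeasurable
  · have h := mgf_gaussianReal hmap t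
    rw [mgf] at h
    rw [h, Real.coe_toNNReal _ (integral_nonneg fun ω => sq_nonneg _)]
    simp

/-- The absolute moments of even order of the standard Gaussian law. -/
noncomputable def gaussianMoment (m : ℕ) : ℝ := ∫ x, |x| ^ (2 * m) ∂(gaussianReal 0 1)

lemma gaussianMoment_nonneg (m : ℕ) : 0 ≤ gaussianMoment m :=
  integral_nonneg fun x => by positivity

/-- By scaling, `X` has the law of `√v` times a standard Gaussian. The power `m` of the variance
lets a large `m` turn any Hölder exponent into as many powers of the distance as chaining needs. -/
lemma gaussian_abs_moment {X : Ω → ℝ} (hX : HasGaussianLaw X P) (h0 : ∫ ω, X ω ∂P = 0) (m : ℕ) :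
    Integrable (fun ω => |X ω| ^ (2 * m)) P ∧
      ∫ ω, |X ω| ^ (2 * m) ∂P = (∫ ω, X ω ^ 2 ∂P) ^ m * gaussianMoment m := by
  have hP := hX.isProbabilityMeasure
  have hmap := map_eq_gaussianReal_of_centered hX h0
  set v := ∫ ω, X ω ^ 2 ∂P with hv
  have hv0 : 0 ≤ v := integral_nonneg fun ω => sq_nonneg _
  constructor
  · have h := (hX.memLp (p := (2 * m : ℕ)) (ENNReal.natCast_ne_top _)).integrable_norm_pow'
    simpa using h
  · have e1 : gaussianReal 0 v.toNNReal = (gaussianReal 0 1).map (√v * ·) := by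
      rw [gaussianReal_map_const_mul]
      congr 1
      · simp
      · ext; simp [Real.sq_sqrt hv0, hv0]
    have e2 : ∫ ω, |X ω| ^ (2 * m) ∂P = ∫ x, |x| ^ (2 * m) ∂(P.map X) := by
      rw [integral_map hX.aemeasurable (by fun_prop)]
    rw [e2, hmap, e1, integral_map (by fun_prop) (by fun_prop), gaussianMoment,
      ← integral_const_mul]
    congr 1; ext x
    rw [abs_mul, mul_pow, abs_of_nonneg (Real.sqrt_nonneg v), pow_mul, Real.sq_sqrt hv0]

lemma abs_exp_sub_one_le_mul {t c : ℝ} (h : |t| ≤ c) : |Real.exp t - 1| ≤ Real.exp c * |t| := by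
  have hc : 0 ≤ c := (abs_nonneg t).trans h
  have h1 := Real.add_one_le_exp t
  have h2 := Real.add_one_le_exp (-t)
  rw [abs_le] at h
  have hpos := Real.exp_pos t
  have h3 : Real.exp t * Real.exp (-t) = 1 := by rw [← Real.exp_add]; simp
  have h4 : Real.exp t - 1 ≤ Real.exp t * t := by nlinarith
  have h5 : Real.exp t ≤ Real.exp c := Real.exp_le_exp.2 h.2
  have h6 : 1 ≤ Real.exp c := Real.one_le_exp hc
  rw [abs_le]
  constructor
  · nlinarith [neg_abs_le t, abs_nonneg t]
  · nlinarith [le_abs_self t, abs_nonneg t]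

namespace IsStationaryGaussianField

lemma isProbabilityMeasure (hG : IsStationaryGaussianField G C P) : IsProbabilityMeasure P :=
  hG.gaussian.isProbabilityMeasure

/-- A modification of a stationary Gaussian field is a stationary Gaussian field. -/
lemma congr {H : ℝ → Ω → ℝ} (hG : IsStationaryGaussianField G C P)
    (hH : ∀ x, H x =ᵐ[P] G x) : IsStationaryGaussianField H C P where
  gaussian := hG.gaussian.congr fun x => (hH x).symm
  mean_zero x := by rw [integral_congr_ae (hH x), hG.mean_zero]
  covariance x y := by
    rw [← hG.covariance x y]
    exact integral_congr_ae ((hH x).mul (hH y))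

lemma integrable_mul (hG : IsStationaryGaussianField G C P) (x y : ℝ) :
    Integrable (fun ω => G x ω * G y ω) P :=
  (hG.gaussian.hasGaussianLaw_eval x).memLp_two.integrable_mul
    (hG.gaussian.hasGaussianLaw_eval y).memLp_two

lemma integral_sq (hG : IsStationaryGaussianField G C P) (x : ℝ) :
    ∫ ω, G x ω ^ 2 ∂P = C 0 := by
  simpa [sq] using hG.covariance x x

lemma covariance_zero_nonneg (hG : IsStationaryGaussianField G C P) : 0 ≤ C 0 := by
  rw [← hG.integral_sq 0]
  exact integral_nonneg fun ω => sq_nonneg _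

lemma integral_sub_sq (hG : IsStationaryGaussianField G C P) (x y : ℝ) :
    ∫ ω, (G x ω - G y ω) ^ 2 ∂P = 2 * (C 0 - C (x - y)) := by
  have e : ∀ ω, (G x ω - G y ω) ^ 2
      = G x ω * G x ω + G y ω * G y ω - 2 * (G x ω * G y ω) := fun ω => by ring
  simp_rw [e]
  have ixx := hG.integrable_mul x x
  have iyy := hG.integrable_mul y y
  have ixy := hG.integrable_mul x y
  rw [integral_sub (f := fun ω => G x ω * G x ω + G y ω * G y ω)
    (ixx.add iyy) (ixy.const_mul 2), integral_add ixx iyy, integral_const_mul,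
    hG.covariance, hG.covariance, hG.covariance]
  simp; ring

lemma integral_add_sq (hG : IsStationaryGaussianField G C P) (x y : ℝ) :
    ∫ ω, (G x ω + G y ω) ^ 2 ∂P = 2 * (C 0 + C (x - y)) := by
  have e : ∀ ω, (G x ω + G y ω) ^ 2
      = G x ω * G x ω + G y ω * G y ω + 2 * (G x ω * G y ω) := fun ω => by ring
  simp_rw [e]
  have ixx := hG.integrable_mul x x
  have iyy := hG.integrable_mul y y
  have ixy := hG.integrable_mul x y
  rw [integral_add (f := fun ω => G x ω * G x ω + G y ω * G y ω)
    (ixx.add iyy) (ixy.const_mul 2), integral_add ixx iyy, integral_const_mul,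
    hG.covariance, hG.covariance, hG.covariance]
  simp; ring

lemma integral_sub_eq_zero (hG : IsStationaryGaussianField G C P) (x y : ℝ) :
    ∫ ω, (G x ω - G y ω) ∂P = 0 := by
  rw [integral_sub (hG.gaussian.hasGaussianLaw_eval x).integrable
    (hG.gaussian.hasGaussianLaw_eval y).integrable, hG.mean_zero, hG.mean_zero, sub_zero]

lemma integral_add_eq_zero (hG : IsStationaryGaussianField G C P) (x y : ℝ) :
    ∫ ω, (G x ω + G y ω) ∂P = 0 := by
  rw [integral_add (hG.gaussian.hasGaussianLaw_eval x).integrable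
    (hG.gaussian.hasGaussianLaw_eval y).integrable, hG.mean_zero, hG.mean_zero, add_zero]

lemma abs_covariance_le (hG : IsStationaryGaussianField G C P) (x : ℝ) : |C x| ≤ C 0 := by
  have h1 : 0 ≤ 2 * (C 0 - C (x - 0)) := by
    rw [← hG.integral_sub_sq]; exact integral_nonneg fun ω => sq_nonneg _
  have h2 : 0 ≤ 2 * (C 0 + C (x - 0)) := by
    rw [← hG.integral_add_sq]; exact integral_nonneg fun ω => sq_nonneg _
  rw [sub_zero] at h1 h2
  rw [abs_le]; constructor <;> linarith

/-- Hölder continuity of the covariance at zero bounds the variance of increments. -/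
lemma exists_increment_le (hG : IsStationaryGaussianField G C P) (hC : HolderAtZero C) :
    ∃ α > 0, ∃ K ≥ 0, ∀ x y, |x - y| ≤ 1 →
      ∫ ω, (G x ω - G y ω) ^ 2 ∂P ≤ K * |x - y| ^ (α : ℝ) := by
  obtain ⟨α, hα, K, δ, hδ, h⟩ := hC
  have hC0 := hG.covariance_zero_nonneg
  -- The first term serves distances below `δ`. The second serves the others, where the variance is
  -- at most `4 * C 0` and `|x - y| ^ α / δ ^ α ≥ 1`.
  refine ⟨α, hα, 2 * |K| + 4 * C 0 / δ ^ α, by positivity, fun x y _ => ?_⟩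
  rw [hG.integral_sub_sq]
  have hp : 0 ≤ |x - y| ^ α := by positivity
  rcases lt_or_ge |x - y| δ with hlt | hge
  · have h1 := (abs_le.1 (h _ hlt)).1
    have h2 : K * |x - y| ^ α ≤ |K| * |x - y| ^ α :=
      mul_le_mul_of_nonneg_right (le_abs_self K) hp
    have h3 : 0 ≤ 4 * C 0 / δ ^ α * |x - y| ^ α := by positivity
    nlinarith
  · have h1 : 1 ≤ |x - y| ^ α / δ ^ α := by
      rw [one_le_div (by positivity)]
      exact Real.rpow_le_rpow hδ.le hge hα.le
    have h2 := (abs_le.1 (hG.abs_covariance_le (x - y))).1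
    have h3 : 0 ≤ 2 * |K| * |x - y| ^ α := by positivity
    have h4 : 4 * C 0 / δ ^ α * |x - y| ^ α = 4 * C 0 * (|x - y| ^ α / δ ^ α) := by ring
    nlinarith

lemma aemeasurable (hG : IsStationaryGaussianField G C P) (x : ℝ) : AEMeasurable (G x) P :=
  hG.gaussian.aemeasurable x

lemma integrable_exp (hG : IsStationaryGaussianField G C P) (t x : ℝ) :
    Integrable (fun ω => Real.exp (t * G x ω)) P :=
  (gaussian_exp_moment (hG.gaussian.hasGaussianLaw_eval x) (hG.mean_zero x) t).1

lemma integral_exp (hG : IsStationaryGaussianField G C P) (t x : ℝ) :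
    ∫ ω, Real.exp (t * G x ω) ∂P = Real.exp (C 0 * t ^ 2 / 2) := by
  rw [(gaussian_exp_moment (hG.gaussian.hasGaussianLaw_eval x) (hG.mean_zero x) t).2,
    hG.integral_sq]

/-- The covariance of the centred exponentials `exp (-G x) - exp (C 0 / 2)`. -/
lemma covariance_exp (hG : IsStationaryGaussianField G C P) (x y : ℝ) :
    Integrable (fun ω => (Real.exp (-G x ω) - Real.exp (C 0 / 2)) *
        (Real.exp (-G y ω) - Real.exp (C 0 / 2))) P ∧
      ∫ ω, (Real.exp (-G x ω) - Real.exp (C 0 / 2)) *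
        (Real.exp (-G y ω) - Real.exp (C 0 / 2)) ∂P =
      Real.exp (C 0) * (Real.exp (C (x - y)) - 1) := by
  have hP := hG.isProbabilityMeasure
  have hsum := gaussian_exp_moment hG.gaussian.hasGaussianLaw_fun_add
    (hG.integral_add_eq_zero x y) (-1)
  rw [hG.integral_add_sq] at hsum
  have hx := hG.integrable_exp (-1) x
  have hy := hG.integrable_exp (-1) y
  have ex := hG.integral_exp (-1) x
  have ey := hG.integral_exp (-1) y
  set μ := Real.exp (C 0 / 2) with hμ
  have hμ2 : μ * μ = Real.exp (C 0) := by rw [hμ, ← Real.exp_add]; ring_nf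
  have e : ∀ ω, (Real.exp (-G x ω) - μ) * (Real.exp (-G y ω) - μ)
      = Real.exp (-1 * (G x ω + G y ω)) - μ * Real.exp (-1 * G x ω)
        - μ * Real.exp (-1 * G y ω) + μ * μ := fun ω => by
    rw [show -1 * (G x ω + G y ω) = -G x ω + -G y ω by ring, Real.exp_add]; simp; ring
  simp_rw [e]
  have i1 : Integrable (fun ω => Real.exp (-1 * (G x ω + G y ω)) - μ * Real.exp (-1 * G x ω)) P :=
    hsum.1.sub (hx.const_mul μ)
  have i2 : Integrable (fun ω => Real.exp (-1 * (G x ω + G y ω)) - μ * Real.exp (-1 * G x ω)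
      - μ * Real.exp (-1 * G y ω)) P := i1.sub (hy.const_mul μ)
  refine ⟨i2.add (integrable_const _), ?_⟩
  rw [integral_add i2 (integrable_const _), integral_sub i1 (hy.const_mul μ),
    integral_sub hsum.1 (hx.const_mul μ), integral_const_mul, integral_const_mul, hsum.2, ex, ey]
  have h1 : Real.exp (C 0 * (-1) ^ 2 / 2) = μ := by rw [hμ]; norm_num
  have h2 : Real.exp (2 * (C 0 + C (x - y)) * (-1) ^ 2 / 2)
      = Real.exp (C 0) * Real.exp (C (x - y)) := by rw [← Real.exp_add]; ring_nf
  rw [h1, h2]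
  simp
  rw [hμ2]; ring

/-- The exponentials inherit the decay of `C`: since `|C| ≤ C 0`, the function `exp - 1` is linearly
bounded on the range of `C`. -/
lemma covariance_exp_le (hG : IsStationaryGaussianField G C P) (x y : ℝ) :
    ∫ ω, (Real.exp (-G x ω) - Real.exp (C 0 / 2)) *
        (Real.exp (-G y ω) - Real.exp (C 0 / 2)) ∂P ≤
      Real.exp (C 0) * (Real.exp (C 0) * |C (x - y)|) := by
  rw [(hG.covariance_exp x y).2]
  exact mul_le_mul_of_nonneg_left ((le_abs_self _).trans
    (abs_exp_sub_one_le_mul (hG.abs_covariance_le _))) (Real.exp_pos _).le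

end IsStationaryGaussianField

end Gaussian

/-! ### Deterministic chaining along dyadic approximations -/

section Chaining

/-- The largest multiple of `2⁻ᵏ` not exceeding `x`. -/
noncomputable def dyadicFloor (k : ℕ) (x : ℝ) : ℝ := (⌊2 ^ k * x⌋ : ℝ) / 2 ^ k

lemma dyadicFloor_le (k : ℕ) (x : ℝ) : dyadicFloor k x ≤ x := by
  rw [dyadicFloor, div_le_iff₀ (by positivity), mul_comm]
  exact Int.floor_le _

lemma lt_dyadicFloor_add (k : ℕ) (x : ℝ) : x < dyadicFloor k x + (1 / 2) ^ k := by
  rw [dyadicFloor, one_div, inv_pow, ← one_div, ← add_div, lt_div_iff₀ (by positivity), mul_comm]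
  exact Int.lt_floor_add_one _

lemma tendsto_dyadicFloor (x : ℝ) : Tendsto (fun k => dyadicFloor k x) atTop (𝓝 x) := by
  have h : Tendsto (fun k : ℕ => x - (1 / 2 : ℝ) ^ k) atTop (𝓝 (x - 0)) :=
    tendsto_const_nhds.sub (tendsto_pow_atTop_nhds_zero_of_lt_one (by norm_num) (by norm_num))
  rw [sub_zero] at h
  refine tendsto_of_tendsto_of_tendsto_of_le_of_le h tendsto_const_nhds (fun k => ?_)
    (fun k => dyadicFloor_le k x)
  have := lt_dyadicFloor_add k x
  simp only; linarith

/-- The increments of `φ` over dyadic intervals of length `2⁻ᵏ` decay like `θᵏ`, with a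
prefactor that grows polynomially in space. -/
def DyadicIncrementBound (φ : ℝ → ℝ) (B s θ : ℝ) : Prop :=
  ∀ (k : ℕ) (i : ℤ), |φ (((i : ℝ) + 1) / 2 ^ k) - φ ((i : ℝ) / 2 ^ k)| ≤
    B * ((1 + |(i : ℝ)|) / 2 ^ k) ^ s * θ ^ k

lemma one_add_abs_div_le {i : ℤ} {k : ℕ} {x : ℝ} (h : |(i : ℝ) / 2 ^ k| ≤ |x| + 1) :
    (1 + |(i : ℝ)|) / 2 ^ k ≤ 2 + |x| := by
  have h2 : (1 : ℝ) ≤ 2 ^ k := one_le_pow₀ (by norm_num)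
  rw [abs_div, abs_of_pos (by positivity : (0 : ℝ) < 2 ^ k)] at h
  rw [add_div]
  have : 1 / (2 : ℝ) ^ k ≤ 1 := by rw [div_le_one (by positivity)]; exact h2
  linarith

lemma abs_floor_div_le (k : ℕ) (x : ℝ) : |(⌊2 ^ k * x⌋ : ℝ) / 2 ^ k| ≤ |x| + 1 := by
  have h1 := dyadicFloor_le k x
  have h2 := lt_dyadicFloor_add k x
  have h3 : (1 / 2 : ℝ) ^ k ≤ 1 := pow_le_one₀ (by norm_num) (by norm_num)
  rw [dyadicFloor] at h1 h2
  rw [abs_le]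
  constructor <;> linarith [neg_abs_le x, le_abs_self x]

namespace DyadicIncrementBound

variable {φ : ℝ → ℝ} {B s θ : ℝ}

lemma step (h : DyadicIncrementBound φ B s θ) (hB : 0 ≤ B) (hs : 0 ≤ s) (hθ : 0 ≤ θ)
    {k : ℕ} {i : ℤ} {x : ℝ} (hi : |(i : ℝ) / 2 ^ k| ≤ |x| + 1) :
    |φ (((i : ℝ) + 1) / 2 ^ k) - φ ((i : ℝ) / 2 ^ k)| ≤ B * (2 + |x|) ^ s * θ ^ k := by
  refine (h k i).trans ?_
  gcongr
  exact one_add_abs_div_le hi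

/-- Passing to the next dyadic level either keeps the approximation of `x` or moves it by one step
of the finer grid. -/
lemma refine_le (h : DyadicIncrementBound φ B s θ) (hB : 0 ≤ B) (hs : 0 ≤ s) (hθ : 0 ≤ θ)
    (hθ1 : θ ≤ 1) (k : ℕ) (x : ℝ) :
    |φ (dyadicFloor (k + 1) x) - φ (dyadicFloor k x)| ≤ B * (2 + |x|) ^ s * θ ^ k := by
  set i := ⌊2 ^ k * x⌋ with hi
  have e : (i : ℝ) / 2 ^ k = ((2 * i : ℤ) : ℝ) / 2 ^ (k + 1) := by
    push_cast; rw [pow_succ]; field_simp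
  have hfl : ⌊2 ^ (k + 1) * x⌋ = 2 * i ∨ ⌊2 ^ (k + 1) * x⌋ = 2 * i + 1 := by
    have h1 : (2 : ℝ) ^ (k + 1) * x = 2 * (2 ^ k * x) := by rw [pow_succ]; ring
    have h2 := Int.floor_le ((2 : ℝ) ^ k * x)
    have h3 := Int.lt_floor_add_one ((2 : ℝ) ^ k * x)
    rw [← hi] at h2 h3
    have h4 : 2 * i ≤ ⌊2 ^ (k + 1) * x⌋ := by
      rw [Int.le_floor, h1]; push_cast; linarith
    have h5 : ⌊2 ^ (k + 1) * x⌋ < 2 * i + 2 := by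
      rw [Int.floor_lt, h1]; push_cast; linarith
    omega
  have hnn : 0 ≤ B * (2 + |x|) ^ s * θ ^ k := by positivity
  rw [dyadicFloor, dyadicFloor, ← hi]
  rcases hfl with hf | hf
  · rw [hf, ← e]; simpa using hnn
  · rw [hf, e]
    have h1 := h.step hB hs hθ (k := k + 1) (i := 2 * i) (x := x)
      (by rw [← e]; exact abs_floor_div_le k x)
    push_cast at h1 ⊢
    refine h1.trans ?_
    refine mul_le_mul_of_nonneg_left ?_ (by positivity)
    exact pow_le_pow_of_le_one hθ hθ1 (Nat.le_succ k)

/-- Points at distance at most `2⁻ᵏ` have equal or adjacent dyadic floors at level `k`, so a single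
increment suffices. -/
lemma neighbour_le (h : DyadicIncrementBound φ B s θ) (hB : 0 ≤ B) (hs : 0 ≤ s) (hθ : 0 ≤ θ)
    {k : ℕ} {x y R : ℝ} (hx : |x| ≤ R) (hxy : x ≤ y) (hd : y - x ≤ (1 / 2) ^ k) :
    |φ (dyadicFloor k y) - φ (dyadicFloor k x)| ≤ B * (2 + R) ^ s * θ ^ k := by
  have hR : 0 ≤ R := (abs_nonneg x).trans hx
  have hnn : 0 ≤ B * (2 + R) ^ s * θ ^ k := by positivity
  have h2k : (0 : ℝ) < 2 ^ k := by positivity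
  have hfl : ⌊2 ^ k * y⌋ = ⌊2 ^ k * x⌋ ∨ ⌊2 ^ k * y⌋ = ⌊2 ^ k * x⌋ + 1 := by
    have h1 : ⌊2 ^ k * x⌋ ≤ ⌊2 ^ k * y⌋ := Int.floor_le_floor (by gcongr)
    have h2 : ⌊2 ^ k * y⌋ < ⌊2 ^ k * x⌋ + 2 := by
      rw [Int.floor_lt]
      push_cast
      have h3 := Int.lt_floor_add_one ((2 : ℝ) ^ k * x)
      have h4 : 2 ^ k * (y - x) ≤ 1 := by
        calc 2 ^ k * (y - x) ≤ 2 ^ k * (1 / 2) ^ k := by gcongr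
          _ = 1 := by rw [← mul_pow]; norm_num
      linarith
    omega
  rw [dyadicFloor, dyadicFloor]
  rcases hfl with hf | hf
  · rw [hf]; simpa using hnn
  · rw [hf]
    push_cast
    refine (h.step hB hs hθ (abs_floor_div_le k x)).trans ?_
    gcongr

variable (h : DyadicIncrementBound φ B s θ) (hB : 0 ≤ B) (hs : 0 ≤ s) (hθ : 0 ≤ θ) (hθ1 : θ < 1)
include h hB hs hθ hθ1

lemma exists_tendsto (x : ℝ) : ∃ l, Tendsto (fun k => φ (dyadicFloor k x)) atTop (𝓝 l) := by
  refine cauchySeq_tendsto_of_complete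
    (cauchySeq_of_le_geometric θ (B * (2 + |x|) ^ s) hθ1 fun k => ?_)
  rw [dist_comm, Real.dist_eq]
  exact h.refine_le hB hs hθ hθ1.le k x

lemma abs_sub_limit_le {x l : ℝ} (hl : Tendsto (fun k => φ (dyadicFloor k x)) atTop (𝓝 l))
    (k : ℕ) : |φ (dyadicFloor k x) - l| ≤ B * (2 + |x|) ^ s * θ ^ k / (1 - θ) := by
  refine dist_le_of_le_geometric_of_tendsto θ (B * (2 + |x|) ^ s) hθ1 (fun k => ?_) hl k
  rw [dist_comm, Real.dist_eq]
  exact h.refine_le hB hs hθ hθ1.le k x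

/-- The limit of a function along dyadic approximations is continuous. -/
lemma continuous_of_tendsto {ψ : ℝ → ℝ}
    (hψ : ∀ x, Tendsto (fun k => φ (dyadicFloor k x)) atTop (𝓝 (ψ x))) : Continuous ψ := by
  have h1θ : 0 < 1 - θ := by linarith
  -- Two geometric tails, from `x` and from `y` to their floors at level `k`, give `2 / (1 - θ)`;
  -- the step between the two floors gives the `1`.
  have key : ∀ (k : ℕ) (x y R : ℝ), |x| ≤ R → |y| ≤ R → x ≤ y → y - x ≤ (1 / 2) ^ k →
      |ψ y - ψ x| ≤ B * (2 + R) ^ s * (2 / (1 - θ) + 1) * θ ^ k := by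
    intro k x y R hx hy hxy hd
    have hR : 0 ≤ R := (abs_nonneg x).trans hx
    have e1 := h.abs_sub_limit_le hB hs hθ hθ1 (hψ x) k
    have e2 := h.abs_sub_limit_le hB hs hθ hθ1 (hψ y) k
    have e3 := h.neighbour_le hB hs hθ hx hxy hd
    have m : ∀ z, |z| ≤ R → B * (2 + |z|) ^ s * θ ^ k / (1 - θ)
        ≤ B * (2 + R) ^ s * θ ^ k / (1 - θ) := by
      intro z hz
      gcongr
    have e4 := e1.trans (m x hx)
    have e5 := e2.trans (m y hy)
    have : B * (2 + R) ^ s * (2 / (1 - θ) + 1) * θ ^ k =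
      B * (2 + R) ^ s * θ ^ k / (1 - θ) + B * (2 + R) ^ s * θ ^ k / (1 - θ)
        + B * (2 + R) ^ s * θ ^ k := by ring
    rw [this]
    rw [abs_le] at e3 e4 e5 ⊢
    constructor <;> linarith [e3.1, e3.2, e4.1, e4.2, e5.1, e5.2]
  rw [Metric.continuous_iff]
  intro x ε hε
  have hlim : Tendsto (fun k : ℕ => B * (2 + (|x| + 1)) ^ s * (2 / (1 - θ) + 1) * θ ^ k)
      atTop (𝓝 0) := by
    simpa using (tendsto_pow_atTop_nhds_zero_of_lt_one hθ hθ1).const_mul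
      (B * (2 + (|x| + 1)) ^ s * (2 / (1 - θ) + 1))
  obtain ⟨k, hk⟩ := (hlim.eventually (gt_mem_nhds hε)).exists
  refine ⟨(1 / 2) ^ k, by positivity, fun y hy => ?_⟩
  have hk1 : (1 / 2 : ℝ) ^ k ≤ 1 := pow_le_one₀ (by norm_num) (by norm_num)
  rw [Real.dist_eq] at hy ⊢
  have hyR : |y| ≤ |x| + 1 := by
    have := abs_sub_abs_le_abs_sub y x
    linarith
  have hxR : |x| ≤ |x| + 1 := by linarith
  rw [abs_lt] at hy
  rcases le_total x y with hxy | hxy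
  · exact (key k x y _ hxR hyR hxy (by linarith)).trans_lt hk
  · rw [abs_sub_comm]
    exact (key k y x _ hyR hxR hxy (by linarith)).trans_lt hk

/-- Chaining from level `0` reduces growth on the whole line to growth along the integers. -/
lemma abs_le_of_continuous (hφ : Continuous φ) (x : ℝ) :
    |φ x| ≤ |φ ⌊x⌋| + B * (2 + |x|) ^ s / (1 - θ) := by
  have hl : Tendsto (fun k => φ (dyadicFloor k x)) atTop (𝓝 (φ x)) :=
    (hφ.tendsto x).comp (tendsto_dyadicFloor x)
  have h0 := h.abs_sub_limit_le hB hs hθ hθ1 hl 0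
  have e : dyadicFloor 0 x = ⌊x⌋ := by simp [dyadicFloor]
  rw [e, pow_zero, mul_one, abs_sub_comm] at h0
  have := abs_sub_abs_le_abs_sub (φ x) (φ ⌊x⌋)
  linarith

end DyadicIncrementBound

end Chaining

/-! ### From moment bounds to almost sure bounds -/

section Kolmogorov

variable {Ω : Type*} [MeasurableSpace Ω] {P : Measure Ω}

/-- A countable family of nonnegative functions with summable integrals is almost everywhere
bounded. -/
lemma ae_bounded_of_summable_lintegral {ι : Type*} [Countable ι] {f : ι → Ω → ℝ} {c : ι → ℝ}
    (hf : ∀ i, AEMeasurable (f i) P) (hc0 : ∀ i, 0 ≤ c i) (hc : Summable c)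
    (hfc : ∀ i, ∫⁻ ω, ENNReal.ofReal (f i ω) ∂P ≤ ENNReal.ofReal (c i)) :
    ∀ᵐ ω ∂P, ∃ M : ℝ, 0 ≤ M ∧ ∀ i, f i ω ≤ M := by
  have hm : ∀ i, AEMeasurable (fun ω => ENNReal.ofReal (f i ω)) P :=
    fun i => (hf i).ennreal_ofReal
  -- The sum of the whole family has finite integral, hence is almost everywhere finite, and it
  -- dominates each term. This plays the role of Borel–Cantelli.
  have hfin : ∫⁻ ω, ∑' i, ENNReal.ofReal (f i ω) ∂P ≠ ⊤ := by
    rw [lintegral_tsum hm]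
    refine ne_top_of_le_ne_top ?_ (ENNReal.tsum_le_tsum hfc)
    rw [← ENNReal.ofReal_tsum_of_nonneg hc0 hc]
    exact ENNReal.ofReal_ne_top
  filter_upwards [ae_lt_top' (AEMeasurable.tsum hm) hfin] with ω hω
  refine ⟨(∑' i, ENNReal.ofReal (f i ω)).toReal, ENNReal.toReal_nonneg, fun i => ?_⟩
  rw [← ENNReal.ofReal_le_iff_le_toReal hω.ne]
  exact ENNReal.le_tsum i

lemma summable_int_inv_sq : Summable fun i : ℤ => ((1 + |(i : ℝ)|) ^ 2)⁻¹ := by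
  have h : Summable fun n : ℕ => ((1 + (n : ℝ)) ^ 2)⁻¹ := by
    have := (summable_nat_add_iff 1).2 (Real.summable_nat_pow_inv (p := 2) |>.2 (by norm_num))
    refine this.congr fun n => ?_
    push_cast; rw [add_comm]
  refine Summable.of_nat_of_neg (by simpa using h) (by simpa using h)

/-- Kolmogorov's moment condition controls all dyadic increments of the paths. -/
lemma ae_dyadicIncrementBound {Z : ℝ → Ω → ℝ} (hZ : ∀ x, AEMeasurable (Z x) P) {p : ℕ}
    (hp : 0 < p) {K : ℝ} (hK : 0 ≤ K)
    (hmom : ∀ x y, |x - y| ≤ 1 →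
      ∫⁻ ω, ENNReal.ofReal (|Z x ω - Z y ω| ^ p) ∂P ≤ ENNReal.ofReal (K * |x - y| ^ 4)) :
    ∀ᵐ ω ∂P, ∃ B : ℝ, 0 ≤ B ∧
      DyadicIncrementBound (fun x => Z x ω) B (2 / p) ((1 / 2) ^ (1 / p : ℝ)) := by
  -- The moment bound gives `K * 2 ^ (-4k)` for each increment and the weight costs `2 ^ (3k) / (1 +
  -- |i|) ^ 2`, so the integral is at most `K * 2⁻ᵏ / (1 + |i|) ^ 2`, summable in both indices. The
  -- `p`-th root of the weight yields the exponent `2 / p` and the ratio `(1 / 2) ^ (1 / p)`.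
  let f : ℕ × ℤ → Ω → ℝ := fun q ω => ((1 / 2) ^ q.1 * ((1 + |(q.2 : ℝ)|) / 2 ^ q.1) ^ 2)⁻¹ *
    |Z (((q.2 : ℝ) + 1) / 2 ^ q.1) ω - Z ((q.2 : ℝ) / 2 ^ q.1) ω| ^ p
  let c : ℕ × ℤ → ℝ := fun q => (1 / 2 : ℝ) ^ q.1 * (K * ((1 + |(q.2 : ℝ)|) ^ 2)⁻¹)
  have hc : Summable c :=
    Summable.mul_of_nonneg (f := fun k : ℕ => (1 / 2 : ℝ) ^ k)
      (g := fun i : ℤ => K * ((1 + |(i : ℝ)|) ^ 2)⁻¹)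
      (summable_geometric_of_lt_one (by norm_num) (by norm_num))
      (summable_int_inv_sq.mul_left K) (fun k => by positivity) (fun i => by positivity)
  have hf : ∀ q, AEMeasurable (f q) P := fun q =>
    ((((hZ _).sub (hZ _)).norm).pow_const p).const_mul _
  have hfc : ∀ q, ∫⁻ ω, ENNReal.ofReal (f q ω) ∂P ≤ ENNReal.ofReal (c q) := by
    rintro ⟨k, i⟩
    have hw : 0 ≤ ((1 / 2 : ℝ) ^ k * ((1 + |(i : ℝ)|) / 2 ^ k) ^ 2)⁻¹ := by positivity
    simp only [f, c]
    simp_rw [ENNReal.ofReal_mul hw]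
    rw [lintegral_const_mul' _ _ ENNReal.ofReal_ne_top]
    have hd : |((i : ℝ) + 1) / 2 ^ k - (i : ℝ) / 2 ^ k| = (1 / 2) ^ k := by
      rw [← sub_div, add_sub_cancel_left, abs_of_pos (by positivity), one_div_pow]
    have h1 := hmom (((i : ℝ) + 1) / 2 ^ k) ((i : ℝ) / 2 ^ k)
      (by rw [hd]; exact pow_le_one₀ (by norm_num) (by norm_num))
    rw [hd] at h1
    refine (mul_le_mul_right h1 _).trans ?_
    rw [← ENNReal.ofReal_mul hw]
    refine ENNReal.ofReal_le_ofReal (le_of_eq ?_)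
    have h2 : (2 : ℝ) ^ k ≠ 0 := by positivity
    have h3 : (1 + |(i : ℝ)|) ≠ 0 := by positivity
    rw [one_div_pow]
    field_simp
  filter_upwards [ae_bounded_of_summable_lintegral hf (fun q => by simp only [c]; positivity)
    hc hfc] with ω ⟨M, hM, hb⟩
  refine ⟨M ^ (1 / p : ℝ), by positivity, fun k i => ?_⟩
  have hb' := hb (k, i)
  simp only [f] at hb'
  set w := (1 + |(i : ℝ)|) / 2 ^ k with hwdef
  have hw : 0 < w := by positivity
  rw [inv_mul_le_iff₀ (by positivity)] at hb'
  have hp' : (p : ℝ) ≠ 0 := by positivity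
  have h1 := Real.rpow_le_rpow (by positivity) hb' (by positivity : (0 : ℝ) ≤ 1 / p)
  rw [one_div, Real.pow_rpow_inv_natCast (abs_nonneg _) hp.ne', ← one_div] at h1
  refine h1.trans (le_of_eq ?_)
  rw [Real.mul_rpow (by positivity) hM, Real.mul_rpow (by positivity) (by positivity),
    ← Real.rpow_natCast w 2, ← Real.rpow_mul hw.le, ← Real.rpow_natCast _ k,
    ← Real.rpow_natCast _ k, ← Real.rpow_mul (by norm_num), ← Real.rpow_mul (by norm_num)]
  push_cast
  rw [show (2 : ℝ) * (1 / p) = 2 / p by ring, mul_comm (k : ℝ)]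
  ring

lemma half_rpow_lt_one {p : ℕ} (hp : 0 < p) : (1 / 2 : ℝ) ^ (1 / p : ℝ) < 1 :=
  Real.rpow_lt_one (by norm_num) (by norm_num) (by positivity)

end Kolmogorov

/-! ### Continuous modification and growth of the paths -/

lemma abs_exp_neg_sub_le (a b : ℝ) :
    |Real.exp (-a) - Real.exp (-b)| ≤ |a - b| * (Real.exp (-a) + Real.exp (-b)) := by
  have ha := Real.exp_pos (-a)
  have hb := Real.exp_pos (-b)
  have h1 : Real.exp (-b) ≤ Real.exp (-a) + |a - b| * Real.exp (-b) := by
    have := Real.add_one_le_exp (b - a)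
    have e : Real.exp (-a) = Real.exp (b - a) * Real.exp (-b) := by rw [← Real.exp_add]; ring_nf
    nlinarith [le_abs_self (a - b)]
  have h2 : Real.exp (-a) ≤ Real.exp (-b) + |a - b| * Real.exp (-a) := by
    have := Real.add_one_le_exp (a - b)
    have e : Real.exp (-b) = Real.exp (a - b) * Real.exp (-a) := by rw [← Real.exp_add]; ring_nf
    nlinarith [neg_abs_le (a - b)]
  have := mul_nonneg (abs_nonneg (a - b)) ha.le
  have := mul_nonneg (abs_nonneg (a - b)) hb.le
  rw [abs_le]; constructor <;> nlinarith

namespace IsStationaryGaussianField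

variable {Ω : Type*} [MeasurableSpace Ω] {P : Measure Ω} {G : ℝ → Ω → ℝ} {C : ℝ → ℝ}

lemma exists_moment_increment_le (hG : IsStationaryGaussianField G C P) (hC : HolderAtZero C)
    (r : ℕ) : ∃ m₀ : ℕ, ∀ m ≥ m₀, ∃ K ≥ 0, ∀ x y, |x - y| ≤ 1 →
      Integrable (fun ω => |G x ω - G y ω| ^ (2 * m)) P ∧
      ∫ ω, |G x ω - G y ω| ^ (2 * m) ∂P ≤ K * |x - y| ^ r := by
  obtain ⟨α, hα, K, hK, h⟩ := hG.exists_increment_le hC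
  -- The moment of order `2 * m` is of order `|x - y| ^ (α * m)`; for `|x - y| ≤ 1` it suffices that
  -- `α * m ≥ r`.
  obtain ⟨m₀, hm₀⟩ := exists_nat_ge (r / α)
  refine ⟨m₀, fun m hm => ⟨K ^ m * gaussianMoment m,
    mul_nonneg (by positivity) (gaussianMoment_nonneg m), fun x y hxy => ?_⟩⟩
  obtain ⟨hi, he⟩ := gaussian_abs_moment hG.gaussian.hasGaussianLaw_fun_sub
    (hG.integral_sub_eq_zero x y) m
  refine ⟨hi, ?_⟩
  rw [he]
  have h1 : (∫ ω, (G x ω - G y ω) ^ 2 ∂P) ^ m ≤ (K * |x - y| ^ α) ^ m :=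
    pow_le_pow_left₀ (integral_nonneg fun ω => sq_nonneg _) (h x y hxy) m
  have h2 : (|x - y| ^ α) ^ m ≤ |x - y| ^ r := by
    rcases eq_or_lt_of_le (abs_nonneg (x - y)) with h0 | h0
    · rw [← h0, Real.zero_rpow hα.ne']
      rcases Nat.eq_zero_or_pos r with hr | hr
      · rw [hr, pow_zero]; exact pow_le_one₀ le_rfl zero_le_one
      · rcases Nat.eq_zero_or_pos m with hm' | hm'
        · exfalso
          have : m₀ = 0 := by omega
          rw [this] at hm₀
          have : 0 < (r : ℝ) / α := by positivity
          simp at hm₀; linarith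
        · rw [zero_pow hm'.ne', zero_pow hr.ne']
    · rw [← Real.rpow_natCast, ← Real.rpow_mul h0.le, ← Real.rpow_natCast]
      refine Real.rpow_le_rpow_of_exponent_ge h0 hxy ?_
      rw [div_le_iff₀ hα] at hm₀
      have : (m₀ : ℝ) ≤ m := by exact_mod_cast hm
      nlinarith
  calc _ ≤ (K * |x - y| ^ α) ^ m * gaussianMoment m :=
        mul_le_mul_of_nonneg_right h1 (gaussianMoment_nonneg m)
    _ = K ^ m * gaussianMoment m * (|x - y| ^ α) ^ m := by rw [mul_pow]; ring
    _ ≤ _ := mul_le_mul_of_nonneg_left h2 (mul_nonneg (by positivity) (gaussianMoment_nonneg m))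

lemma exists_lintegral_increment_le (hG : IsStationaryGaussianField G C P)
    (hC : HolderAtZero C) : ∃ p > 0, ∃ K ≥ 0, ∀ x y, |x - y| ≤ 1 →
      ∫⁻ ω, ENNReal.ofReal (|G x ω - G y ω| ^ p) ∂P ≤ ENNReal.ofReal (K * |x - y| ^ 4) := by
  obtain ⟨m, hm⟩ := hG.exists_moment_increment_le hC 4
  obtain ⟨K, hK, h⟩ := hm (m + 1) (by omega)
  refine ⟨2 * (m + 1), by omega, K, hK, fun x y hxy => ?_⟩
  rw [← ofReal_integral_eq_lintegral_ofReal (h x y hxy).1 (ae_of_all _ fun ω => by positivity)]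
  exact ENNReal.ofReal_le_ofReal (h x y hxy).2

/-- The increment of `exp (-G)` is at most the increment of `G` times a sum of exponentials having
all moments. A weighted Young inequality separates the two factors, which is why eight powers of the
distance are required of `G` to obtain four here. -/
lemma exists_lintegral_exp_increment_le (hG : IsStationaryGaussianField G C P)
    (hC : HolderAtZero C) : ∃ p₀ : ℕ, ∀ p ≥ p₀, ∃ K ≥ 0, ∀ x y, |x - y| ≤ 1 →
      ∫⁻ ω, ENNReal.ofReal (|Real.exp (-G x ω) - Real.exp (-G y ω)| ^ p) ∂P ≤
        ENNReal.ofReal (K * |x - y| ^ 4) := by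
  obtain ⟨p₀, hp₀⟩ := hG.exists_moment_increment_le hC 8
  refine ⟨p₀ + 1, fun p hp => ?_⟩
  obtain ⟨K, hK, h⟩ := hp₀ p (by omega)
  set E := Real.exp (C 0 * (-(2 * p : ℕ)) ^ 2 / 2) with hE
  refine ⟨K + 2 ^ (2 * p - 1) * (2 * E), by positivity, fun x y hxy => ?_⟩
  -- Coinciding points are set apart because the weight below divides by the distance.
  rcases eq_or_lt_of_le (abs_nonneg (x - y)) with h0 | h0
  · have : x = y := by rw [← sub_eq_zero, ← abs_eq_zero]; exact h0.symm
    subst this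
    simp [show p ≠ 0 by omega]
  set d := |x - y| with hd
  obtain ⟨hi, hle⟩ := h x y hxy
  have ix := hG.integrable_exp (-(2 * p : ℕ)) x
  have iy := hG.integrable_exp (-(2 * p : ℕ)) y
  have ixy : Integrable (fun ω => Real.exp (-(2 * p : ℕ) * G x ω)
      + Real.exp (-(2 * p : ℕ) * G y ω)) P := ix.add iy
  have hdom : ∀ ω, |Real.exp (-G x ω) - Real.exp (-G y ω)| ^ p ≤
      (d ^ 4)⁻¹ * |G x ω - G y ω| ^ (2 * p) + d ^ 4 * (2 ^ (2 * p - 1) *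
        (Real.exp (-(2 * p : ℕ) * G x ω) + Real.exp (-(2 * p : ℕ) * G y ω))) := by
    intro ω
    set W := Real.exp (-G x ω) + Real.exp (-G y ω) with hW
    have hW0 : 0 ≤ W := by positivity
    have h1 : |Real.exp (-G x ω) - Real.exp (-G y ω)| ^ p ≤ |G x ω - G y ω| ^ p * W ^ p := by
      rw [← mul_pow]
      exact pow_le_pow_left₀ (abs_nonneg _) (abs_exp_neg_sub_le _ _) p
    have h2 : W ^ (2 * p) ≤ 2 ^ (2 * p - 1) *
        (Real.exp (-(2 * p : ℕ) * G x ω) + Real.exp (-(2 * p : ℕ) * G y ω)) := by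
      refine (add_pow_le (Real.exp_pos _).le (Real.exp_pos _).le (2 * p)).trans (le_of_eq ?_)
      rw [← Real.exp_nat_mul, ← Real.exp_nat_mul]
      ring_nf
    -- Young's inequality with weights `d ^ (-2)` and `d ^ 2`: after integration both terms are of
    -- order `d ^ 4`.
    have h3 : |G x ω - G y ω| ^ p * W ^ p ≤
        (d ^ 4)⁻¹ * |G x ω - G y ω| ^ (2 * p) + d ^ 4 * W ^ (2 * p) := by
      set A := |G x ω - G y ω| ^ p with hA
      have hA0 : 0 ≤ A := by positivity
      have e1 : |G x ω - G y ω| ^ (2 * p) = A ^ 2 := by rw [hA, ← pow_mul, mul_comm]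
      have e2 : W ^ (2 * p) = (W ^ p) ^ 2 := by rw [← pow_mul, mul_comm]
      rw [e1, e2]
      have hd2 : (d ^ 4)⁻¹ * A ^ 2 = ((d ^ 2)⁻¹ * A) ^ 2 := by field_simp
      have hd3 : d ^ 4 * (W ^ p) ^ 2 = (d ^ 2 * W ^ p) ^ 2 := by ring
      have hd4 : A * W ^ p = ((d ^ 2)⁻¹ * A) * (d ^ 2 * W ^ p) := by field_simp
      rw [hd2, hd3, hd4]
      have : 0 ≤ ((d ^ 2)⁻¹ * A) * (d ^ 2 * W ^ p) := by positivity
      nlinarith [sq_nonneg ((d ^ 2)⁻¹ * A - d ^ 2 * W ^ p)]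
    refine h1.trans (h3.trans ?_)
    gcongr
  refine (lintegral_mono fun ω => ENNReal.ofReal_le_ofReal (hdom ω)).trans ?_
  have i1 := hi.const_mul (d ^ 4)⁻¹
  have i2 := (ixy.const_mul (2 ^ (2 * p - 1))).const_mul (d ^ 4)
  rw [← ofReal_integral_eq_lintegral_ofReal (by exact i1.add i2) (ae_of_all _ fun ω => by
    simp only [Pi.zero_apply]; positivity)]
  refine ENNReal.ofReal_le_ofReal ?_
  rw [integral_add i1 i2, integral_const_mul, integral_const_mul, integral_const_mul,
    integral_add ix iy, hG.integral_exp, hG.integral_exp, ← hE]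
  calc _ ≤ (d ^ 4)⁻¹ * (K * d ^ 8) + d ^ 4 * (2 ^ (2 * p - 1) * (E + E)) := by gcongr
    _ = _ := by field_simp; ring

/-- The modification is the pathwise limit of `G` along dyadic floors, continuous by chaining. It
agrees with `G x` almost surely for each `x` because the moment bound, summed over `k`, also forces
`G (dyadicFloor k x)` to converge to `G x`. -/
theorem exists_continuousModification (hG : IsStationaryGaussianField G C P)
    (hC : HolderAtZero C) : ∃ H : ℝ → Ω → ℝ, IsContinuousModification H G P := by
  obtain ⟨p, hp, K, hK, hmom⟩ := hG.exists_lintegral_increment_le hC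
  have hbound := ae_dyadicIncrementBound hG.aemeasurable hp hK hmom
  have hθ := half_rpow_lt_one hp
  have hs : (0 : ℝ) ≤ 2 / p := by positivity
  have hθ0 : (0 : ℝ) ≤ (1 / 2) ^ (1 / p : ℝ) := by positivity
  let H : ℝ → Ω → ℝ := fun x ω => limUnder atTop fun k => G (dyadicFloor k x) ω
  have hlim : ∀ ω, (∃ B : ℝ, 0 ≤ B ∧
      DyadicIncrementBound (fun x => G x ω) B (2 / p) ((1 / 2) ^ (1 / p : ℝ))) →
      ∀ x, Tendsto (fun k => G (dyadicFloor k x) ω) atTop (𝓝 (H x ω)) :=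
    fun ω ⟨B, hB, hb⟩ x => tendsto_nhds_limUnder (hb.exists_tendsto hB hs hθ0 hθ x)
  refine ⟨H, fun x => ?_, ?_⟩
  -- The factor `2 ^ k` still leaves summable integrals, and boundedness of `f` then gives `|G
  -- (dyadicFloor k x) - G x| ^ p ≤ M * 2⁻ᵏ`.
  · let f : ℕ → Ω → ℝ := fun k ω => 2 ^ k * |G (dyadicFloor k x) ω - G x ω| ^ p
    have hd : ∀ k, |dyadicFloor k x - x| ≤ (1 / 2) ^ k := fun k => by
      have h1 := dyadicFloor_le k x
      have h2 := lt_dyadicFloor_add k x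
      rw [abs_le]
      constructor <;> linarith
    have hfc : ∀ k, ∫⁻ ω, ENNReal.ofReal (f k ω) ∂P ≤ ENNReal.ofReal (K * (1 / 2) ^ k) := by
      intro k
      have h2 : (0 : ℝ) ≤ 2 ^ k := by positivity
      have hk1 : (1 / 2 : ℝ) ^ k ≤ 1 := pow_le_one₀ (by norm_num) (by norm_num)
      simp only [f]
      simp_rw [ENNReal.ofReal_mul h2]
      rw [lintegral_const_mul' _ _ ENNReal.ofReal_ne_top]
      refine (mul_le_mul_right (hmom _ _ ((hd k).trans hk1)) _).trans ?_
      rw [← ENNReal.ofReal_mul h2]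
      refine ENNReal.ofReal_le_ofReal ?_
      have h3 : |dyadicFloor k x - x| ^ 4 ≤ (1 / 2) ^ k * (1 / 2) ^ k := by
        calc |dyadicFloor k x - x| ^ 4 ≤ ((1 / 2) ^ k) ^ 4 :=
              pow_le_pow_left₀ (abs_nonneg _) (hd k) 4
          _ ≤ ((1 / 2) ^ k) ^ 2 := pow_le_pow_of_le_one (by positivity) hk1 (by norm_num)
          _ = _ := sq _
      have h4 : (2 : ℝ) ^ k * (1 / 2) ^ k = 1 := by rw [← mul_pow]; norm_num
      calc 2 ^ k * (K * |dyadicFloor k x - x| ^ 4)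
          ≤ 2 ^ k * (K * ((1 / 2) ^ k * (1 / 2) ^ k)) := by gcongr
        _ = 2 ^ k * (1 / 2) ^ k * (K * (1 / 2) ^ k) := by ring
        _ = _ := by rw [h4, one_mul]
    have hsum : Summable fun k : ℕ => K * (1 / 2 : ℝ) ^ k :=
      (summable_geometric_of_lt_one (by norm_num) (by norm_num)).mul_left K
    filter_upwards [hbound, ae_bounded_of_summable_lintegral
      (fun k => (((hG.aemeasurable _).sub (hG.aemeasurable _)).norm.pow_const p).const_mul _)
      (fun k => by positivity) hsum hfc] with ω hω ⟨M, hM, hfM⟩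
    refine tendsto_nhds_unique (hlim ω hω x) ?_
    rw [tendsto_iff_dist_tendsto_zero]
    have hz : Tendsto (fun k : ℕ => (M * (1 / 2 : ℝ) ^ k) ^ (1 / p : ℝ)) atTop (𝓝 0) := by
      have h1 : Tendsto (fun k : ℕ => M * (1 / 2 : ℝ) ^ k) atTop (𝓝 0) := by
        simpa using (tendsto_pow_atTop_nhds_zero_of_lt_one (r := (1 / 2 : ℝ))
          (by norm_num) (by norm_num)).const_mul M
      have h2 := h1.rpow_const (p := (1 / p : ℝ)) (Or.inr (by positivity))
      rwa [Real.zero_rpow (by positivity)] at h2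
    refine squeeze_zero (fun k => dist_nonneg) (fun k => ?_) hz
    rw [Real.dist_eq]
    have h1 := hfM k
    have h2 : |G (dyadicFloor k x) ω - G x ω| ^ p ≤ M * (1 / 2) ^ k := by
      rw [one_div_pow, mul_one_div, le_div_iff₀ (by positivity), mul_comm]; exact h1
    have h3 := Real.rpow_le_rpow (by positivity) h2 (by positivity : (0 : ℝ) ≤ 1 / p)
    rwa [one_div, Real.pow_rpow_inv_natCast (abs_nonneg _) hp.ne', ← one_div] at h3
  · filter_upwards [hbound] with ω hω
    obtain ⟨B, hB, hb⟩ := hω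
    exact hb.continuous_of_tendsto hB hs hθ0 hθ (hlim ω ⟨B, hB, hb⟩)

/-- Almost surely, `exp (-G)` grows slower than any given power. -/
theorem ae_exp_neg_le (hG : IsStationaryGaussianField G C P) (hC : HolderAtZero C)
    (hcont : ∀ᵐ ω ∂P, Continuous fun x => G x ω) {s : ℝ} (hs : 0 < s) :
    ∀ᵐ ω ∂P, ∃ M : ℝ, 0 ≤ M ∧ ∀ x, Real.exp (-G x ω) ≤ M * (2 + |x|) ^ s := by
  obtain ⟨p₀, hp₀⟩ := hG.exists_lintegral_exp_increment_le hC
  obtain ⟨p₁, hp₁⟩ := exists_nat_ge (2 / s)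
  -- The chaining exponent is `2 / p`, so `p ≥ 2 / s` brings it below `s`.
  set p := p₀ + p₁ + 1 with hpdef
  have hp : 0 < p := by omega
  obtain ⟨K, hK, hmom⟩ := hp₀ p (by omega)
  have hps : (2 : ℝ) / p ≤ s := by
    rw [div_le_iff₀ (by positivity)]
    rw [div_le_iff₀ hs] at hp₁
    have : (p₁ : ℝ) ≤ p := by rw [hpdef]; push_cast; linarith [(Nat.cast_nonneg p₀ : (0:ℝ) ≤ p₀)]
    nlinarith
  have hZ : ∀ x, AEMeasurable (fun ω => Real.exp (-G x ω)) P := fun x =>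
    Real.measurable_exp.comp_aemeasurable (hG.aemeasurable x).neg
  have hbound := ae_dyadicIncrementBound (Z := fun x ω => Real.exp (-G x ω)) hZ hp hK hmom
  have hθ := half_rpow_lt_one hp
  have hs' : (0 : ℝ) ≤ 2 / p := by positivity
  have hθ0 : (0 : ℝ) ≤ (1 / 2) ^ (1 / p : ℝ) := by positivity
  set θ : ℝ := (1 / 2) ^ (1 / p : ℝ)
  set E := Real.exp (C 0 * (-(p : ℝ)) ^ 2 / 2) with hE
  -- By stationarity the `p`-th moment of `exp (-G i)` does not depend on `i`; the weight makes the
  -- family summable and costs growth of order `2 / p` along the integers.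
  let f : ℤ → Ω → ℝ := fun i ω => ((1 + |(i : ℝ)|) ^ 2)⁻¹ * Real.exp (-(p : ℝ) * G i ω)
  have hfc : ∀ i, ∫⁻ ω, ENNReal.ofReal (f i ω) ∂P ≤
      ENNReal.ofReal (((1 + |(i : ℝ)|) ^ 2)⁻¹ * E) := by
    intro i
    rw [← ofReal_integral_eq_lintegral_ofReal ((hG.integrable_exp _ _).const_mul _)
      (ae_of_all _ fun ω => by positivity), integral_const_mul, hG.integral_exp]
  filter_upwards [hbound, hcont, ae_bounded_of_summable_lintegral (f := f)
      (fun i => (hG.integrable_exp (-(p : ℝ)) i).aemeasurable.const_mul _)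
      (fun k => by positivity) (summable_int_inv_sq.mul_right E) hfc]
    with ω ⟨B, hB, hb⟩ hc ⟨M, hM, hfM⟩
  have h1θ : 0 < 1 - θ := by linarith
  refine ⟨M ^ (1 / p : ℝ) + B / (1 - θ), by positivity, fun x => ?_⟩
  have h1 := hb.abs_le_of_continuous hB hs' hθ0 hθ (Real.continuous_exp.comp hc.neg) x
  simp only [abs_of_pos (Real.exp_pos _)] at h1
  have h2 : Real.exp (-G ⌊x⌋ ω) ≤ M ^ (1 / p : ℝ) * (2 + |x|) ^ (2 / p : ℝ) := by
    have h3 := hfM ⌊x⌋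
    simp only [f] at h3
    rw [inv_mul_le_iff₀ (by positivity)] at h3
    have hfl : 1 + |(⌊x⌋ : ℝ)| ≤ 2 + |x| := by
      have := abs_floor_div_le 0 x
      simp at this; linarith
    have h4 : Real.exp (-G ⌊x⌋ ω) ^ p ≤ (2 + |x|) ^ 2 * M := by
      calc Real.exp (-G ⌊x⌋ ω) ^ p = Real.exp (-(p : ℝ) * G ⌊x⌋ ω) := by
            rw [← Real.exp_nat_mul]; ring_nf
        _ ≤ _ := h3
        _ ≤ _ := by gcongr
    have h5 := Real.rpow_le_rpow (by positivity) h4 (by positivity : (0 : ℝ) ≤ 1 / p)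
    rw [one_div, Real.pow_rpow_inv_natCast (Real.exp_pos _).le hp.ne', ← one_div,
      Real.mul_rpow (by positivity) hM, ← Real.rpow_natCast _ 2,
      ← Real.rpow_mul (by positivity)] at h5
    rw [mul_comm]
    push_cast at h5
    rwa [mul_one_div] at h5
  have h6 : (2 + |x|) ^ (2 / p : ℝ) ≤ (2 + |x|) ^ s :=
    Real.rpow_le_rpow_of_exponent_le (by linarith [abs_nonneg x]) hps
  calc Real.exp (-G x ω) ≤ (M ^ (1 / p : ℝ) + B / (1 - θ)) * (2 + |x|) ^ (2 / p : ℝ) := by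
        refine h1.trans ((add_le_add_left h2 _).trans (le_of_eq ?_)); ring
    _ ≤ _ := by gcongr

end IsStationaryGaussianField

/-! ### Second moments of time averages -/

section RiemannSums

/-- Left Riemann sums of a continuous function on the unit interval converge to its integral. -/
lemma tendsto_riemannSum_unitInterval {φ : ℝ → ℝ} (hφ : Continuous φ) :
    Tendsto (fun n : ℕ => ((n : ℝ) + 1)⁻¹ * ∑ l ∈ Finset.range (n + 1), φ (l / ((n : ℝ) + 1)))
      atTop (𝓝 (∫ s in (0 : ℝ)..1, φ s)) := by
  rw [Metric.tendsto_atTop]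
  intro ε hε
  have huc := isCompact_Icc.uniformContinuousOn_of_continuous (s := Icc (0 : ℝ) 1) hφ.continuousOn
  rw [Metric.uniformContinuousOn_iff] at huc
  obtain ⟨δ, hδ, huc⟩ := huc (ε / 2) (by positivity)
  obtain ⟨n₀, hn₀⟩ := exists_nat_one_div_lt hδ
  refine ⟨n₀, fun n hn => ?_⟩
  set r : ℝ := (n : ℝ) + 1 with hr
  have hr0 : 0 < r := by positivity
  have hrδ : 1 / r < δ := by
    refine lt_of_le_of_lt ?_ hn₀
    have : (n₀ : ℝ) ≤ n := by exact_mod_cast hn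
    rw [hr]
    gcongr
  have hsplit : ∫ s in (0 : ℝ)..1, φ s =
      ∑ l ∈ Finset.range (n + 1), ∫ s in ((l : ℝ) / r)..((l + 1 : ℕ) : ℝ) / r, φ s := by
    rw [intervalIntegral.sum_integral_adjacent_intervals (a := fun l : ℕ => (l : ℝ) / r)
      fun k _ => hφ.intervalIntegrable _ _]
    congr 1
    · simp
    · push_cast; rw [← hr, div_self hr0.ne']
  have hpiece : ∀ l ∈ Finset.range (n + 1),
      |r⁻¹ * φ (l / r) - ∫ s in ((l : ℝ) / r)..((l + 1 : ℕ) : ℝ) / r, φ s| ≤ ε / 2 * r⁻¹ := by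
    intro l hl
    have hlen : ((l + 1 : ℕ) : ℝ) / r - (l : ℝ) / r = r⁻¹ := by
      push_cast; rw [← sub_div, add_sub_cancel_left, one_div]
    have hle : (l : ℝ) / r ≤ ((l + 1 : ℕ) : ℝ) / r := by push_cast; gcongr; linarith
    have e : r⁻¹ * φ (l / r) - ∫ s in ((l : ℝ) / r)..((l + 1 : ℕ) : ℝ) / r, φ s =
        ∫ s in ((l : ℝ) / r)..((l + 1 : ℕ) : ℝ) / r, (φ (l / r) - φ s) := by
      rw [intervalIntegral.integral_sub (by simp) (hφ.intervalIntegrable _ _),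
        intervalIntegral.integral_const, hlen, smul_eq_mul]
    have hl1 : ((l + 1 : ℕ) : ℝ) / r ≤ 1 := by
      rw [div_le_one hr0, hr]
      have : l + 1 ≤ n + 1 := by simpa using Finset.mem_range.1 hl
      exact_mod_cast this
    have hl0 : 0 ≤ (l : ℝ) / r := by positivity
    rw [e, ← Real.norm_eq_abs]
    refine (intervalIntegral.norm_integral_le_of_norm_le_const (C := ε / 2) fun s hs => ?_).trans ?_
    · rw [uIoc_of_le hle] at hs
      rw [← dist_eq_norm]
      refine (huc _ ⟨hl0, hle.trans hl1⟩ _ ⟨hl0.trans hs.1.le, hs.2.trans hl1⟩ ?_).le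
      rw [Real.dist_eq, abs_lt]
      rw [one_div] at hrδ
      constructor <;> linarith [hs.1, hs.2]
    · rw [hlen, abs_of_pos (by positivity)]
  rw [Real.dist_eq, hsplit, Finset.mul_sum, ← Finset.sum_sub_distrib]
  calc _ ≤ ∑ l ∈ Finset.range (n + 1), ε / 2 * r⁻¹ :=
        (Finset.abs_sum_le_sum_abs _ _).trans (Finset.sum_le_sum hpiece)
    _ = ε / 2 := by
        rw [Finset.sum_const, Finset.card_range, nsmul_eq_mul]; push_cast; rw [← hr]
        field_simp
    _ < ε := by linarith

variable {Ω : Type*} [MeasurableSpace Ω] {P : Measure Ω}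

/-- Jensen's inequality for the time average of a process with continuous paths. -/
lemma lintegral_sq_unitInterval_le {X : ℝ → Ω → ℝ} (hm : ∀ x, AEMeasurable (X x) P)
    (hcont : ∀ᵐ ω ∂P, Continuous fun x => X x ω) {A : ENNReal}
    (hA : ∀ x, ∫⁻ ω, ENNReal.ofReal (X x ω ^ 2) ∂P ≤ A) :
    AEMeasurable (fun ω => ∫ s in (0 : ℝ)..1, X s ω) P ∧
      ∫⁻ ω, ENNReal.ofReal ((∫ s in (0 : ℝ)..1, X s ω) ^ 2) ∂P ≤ A := by
  -- Riemann sums need measurability of each `X x` only, not joint measurability. Cauchy–Schwarz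
  -- bounds their second moments and Fatou's lemma passes to the integral.
  let R : ℕ → Ω → ℝ := fun n ω =>
    ((n : ℝ) + 1)⁻¹ * ∑ l ∈ Finset.range (n + 1), X (l / ((n : ℝ) + 1)) ω
  have hR : ∀ n, AEMeasurable (R n) P := fun n =>
    (Finset.aemeasurable_fun_sum _ fun l _ => hm _).const_mul _
  have hlim : ∀ᵐ ω ∂P, Tendsto (fun n => R n ω) atTop (𝓝 (∫ s in (0 : ℝ)..1, X s ω)) := by
    filter_upwards [hcont] with ω hω using tendsto_riemannSum_unitInterval hω
  refine ⟨aemeasurable_of_tendsto_metrizable_ae _ hR hlim, ?_⟩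
  have hRA : ∀ n, ∫⁻ ω, ENNReal.ofReal (R n ω ^ 2) ∂P ≤ A := by
    intro n
    set r : ℝ := (n : ℝ) + 1 with hr
    have hr0 : 0 < r := by positivity
    have h1 : ∀ ω, ENNReal.ofReal (R n ω ^ 2) ≤
        ENNReal.ofReal r⁻¹ * ∑ l ∈ Finset.range (n + 1), ENNReal.ofReal (X (l / r) ω ^ 2) := by
      intro ω
      rw [← ENNReal.ofReal_sum_of_nonneg fun i _ => sq_nonneg _,
        ← ENNReal.ofReal_mul (by positivity)]
      refine ENNReal.ofReal_le_ofReal ?_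
      have h2 := sq_sum_le_card_mul_sum_sq (s := Finset.range (n + 1))
        (f := fun l : ℕ => X (l / r) ω)
      rw [Finset.card_range] at h2
      push_cast at h2
      rw [← hr] at h2
      simp only [R]
      rw [mul_pow, ← hr]
      calc _ ≤ r⁻¹ ^ 2 * (r * ∑ l ∈ Finset.range (n + 1), X (l / r) ω ^ 2) := by gcongr
        _ = _ := by field_simp
    refine (lintegral_mono h1).trans ?_
    rw [lintegral_const_mul' _ _ ENNReal.ofReal_ne_top,
      lintegral_finsetSum' _ fun l _ => ((hm _).pow_const 2).ennreal_ofReal]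
    calc _ ≤ ENNReal.ofReal r⁻¹ * ∑ l ∈ Finset.range (n + 1), A := by
          gcongr with l _; exact hA _
      _ = ENNReal.ofReal r⁻¹ * ENNReal.ofReal r * A := by
          rw [Finset.sum_const, Finset.card_range, nsmul_eq_mul, mul_assoc, hr,
            ENNReal.ofReal_add (by positivity) (by positivity)]
          simp
      _ = A := by
          rw [← ENNReal.ofReal_mul (by positivity), inv_mul_cancel₀ hr0.ne']; simp
  calc ∫⁻ ω, ENNReal.ofReal ((∫ s in (0 : ℝ)..1, X s ω) ^ 2) ∂P
      = ∫⁻ ω, liminf (fun n => ENNReal.ofReal (R n ω ^ 2)) atTop ∂P := by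
        refine lintegral_congr_ae ?_
        filter_upwards [hlim] with ω hω
        exact ((ENNReal.continuous_ofReal.tendsto _).comp (hω.pow 2)).liminf_eq.symm
    _ ≤ liminf (fun n => ∫⁻ ω, ENNReal.ofReal (R n ω ^ 2) ∂P) atTop :=
        lintegral_liminf_le' fun n => ((hR n).pow_const 2).ennreal_ofReal
    _ ≤ liminf (fun _ : ℕ => A) atTop := liminf_le_liminf (Eventually.of_forall hRA)
    _ = A := liminf_const A

end RiemannSums

/-! ### Deterministic bounds for double sums and gaps between powers -/

section DoubleSums

lemma card_near_le (N L i : ℕ) :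
    ((Finset.range N).filter fun j : ℕ => |(i : ℝ) - j| < L).card ≤ 2 * L := by
  have hsub : ((Finset.range N).filter fun j : ℕ => |(i : ℝ) - j| < L) ⊆
      Finset.Ico (i + 1 - L) (i + L) := by
    intro j hj
    rw [Finset.mem_filter, abs_lt] at hj
    obtain ⟨-, h1, h2⟩ := hj
    have h3 : j < i + L := by
      have : (j : ℝ) < i + L := by linarith
      exact_mod_cast this
    have h4 : i < j + L := by
      have : (i : ℝ) < j + L := by linarith
      exact_mod_cast this
    rw [Finset.mem_Ico]; omega
  refine (Finset.card_le_card hsub).trans ?_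
  rw [Nat.card_Ico]; omega

/-- Each row has at most `2 * L` entries within distance `L` of the diagonal, bounded by `c₀`; the
decay of `C` handles the others. The cutoff `L` stays free, to be balanced against `N`. -/
lemma sum_sum_decay_le {C : ℝ → ℝ} {K β c₀ : ℝ} (hβ : 0 < β) (hK : 0 ≤ K) (h0 : ∀ x, |C x| ≤ c₀)
    (hC : ∀ x, |C x| ≤ K * (1 + |x|) ^ (-β)) (N : ℕ) {L : ℕ} (hL : 0 < L) :
    ∑ i ∈ Finset.range N, ∑ j ∈ Finset.range N, |C ((i : ℝ) - j)| ≤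
      N * (2 * L * c₀ + N * (K * (L : ℝ) ^ (-β))) := by
  have hc0 : 0 ≤ c₀ := (abs_nonneg _).trans (h0 0)
  have hL' : (0 : ℝ) < L := by exact_mod_cast hL
  have hrow : ∀ i ∈ Finset.range N, ∑ j ∈ Finset.range N, |C ((i : ℝ) - j)| ≤
      2 * L * c₀ + N * (K * (L : ℝ) ^ (-β)) := by
    intro i _
    have hpt : ∀ j ∈ Finset.range N, |C ((i : ℝ) - j)| ≤
        (if |(i : ℝ) - j| < L then c₀ else 0) + K * (L : ℝ) ^ (-β) := by
      intro j _
      have hnn : 0 ≤ K * (L : ℝ) ^ (-β) := by positivity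
      split_ifs with h
      · linarith [h0 ((i : ℝ) - j)]
      · rw [zero_add]
        refine (hC _).trans (mul_le_mul_of_nonneg_left ?_ hK)
        exact Real.rpow_le_rpow_of_nonpos hL' (by linarith [not_lt.1 h]) (by linarith)
    refine (Finset.sum_le_sum hpt).trans ?_
    rw [Finset.sum_add_distrib, ← Finset.sum_filter, Finset.sum_const, Finset.sum_const,
      Finset.card_range, nsmul_eq_mul, nsmul_eq_mul]
    have : (((Finset.range N).filter fun j : ℕ => |(i : ℝ) - j| < L).card : ℝ) ≤ 2 * L := by
      exact_mod_cast card_near_le N L i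
    gcongr
  refine (Finset.sum_le_sum hrow).trans ?_
  rw [Finset.sum_const, Finset.card_range, nsmul_eq_mul]

lemma add_one_pow_sub_pow_le (n m : ℕ) :
    ((n : ℝ) + 1) ^ (m + 1) - (n : ℝ) ^ (m + 1) ≤ (m + 1) * ((n : ℝ) + 1) ^ m := by
  induction m with
  | zero => simp
  | succ m ih =>
    have h1 : (n : ℝ) ^ (m + 1) ≤ ((n : ℝ) + 1) ^ (m + 1) := by gcongr; linarith
    have h2 : (0 : ℝ) ≤ (n : ℝ) + 1 := by positivity
    have h3 := mul_le_mul_of_nonneg_left ih h2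
    push_cast
    calc ((n : ℝ) + 1) ^ (m + 1 + 1) - (n : ℝ) ^ (m + 1 + 1)
        = ((n : ℝ) + 1) * (((n : ℝ) + 1) ^ (m + 1) - (n : ℝ) ^ (m + 1)) + (n : ℝ) ^ (m + 1) := by
          ring
      _ ≤ ((n : ℝ) + 1) * ((m + 1) * ((n : ℝ) + 1) ^ m) + ((n : ℝ) + 1) ^ (m + 1) :=
          add_le_add h3 h1
      _ = _ := by ring

end DoubleSums

/-! ### A quantitative law of large numbers -/

namespace IsStationaryGaussianField

variable {Ω : Type*} [MeasurableSpace Ω] {P : Measure Ω} {G : ℝ → Ω → ℝ} {C : ℝ → ℝ}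

lemma lintegral_sum_sq_le (hG : IsStationaryGaussianField G C P) (N : ℕ) (s : ℝ) :
    ∫⁻ ω, ENNReal.ofReal
        ((∑ i ∈ Finset.range N, (Real.exp (-G (i + s) ω) - Real.exp (C 0 / 2))) ^ 2) ∂P ≤
      ENNReal.ofReal (Real.exp (C 0) * (Real.exp (C 0) *
        ∑ i ∈ Finset.range N, ∑ j ∈ Finset.range N, |C ((i : ℝ) - j)|)) := by
  simp_rw [sq, Finset.sum_mul_sum]
  have hi : ∀ i j : ℕ, Integrable (fun ω => (Real.exp (-G (i + s) ω) - Real.exp (C 0 / 2)) *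
      (Real.exp (-G (j + s) ω) - Real.exp (C 0 / 2))) P := fun i j =>
    (hG.covariance_exp _ _).1
  rw [← ofReal_integral_eq_lintegral_ofReal
    (integrable_finsetSum _ fun i _ => integrable_finsetSum _ fun j _ => hi i j)
    (ae_of_all _ fun ω => by
      simp only [Pi.zero_apply]
      rw [← Finset.sum_mul_sum]
      exact mul_self_nonneg _)]
  refine ENNReal.ofReal_le_ofReal ?_
  rw [integral_finsetSum _ fun i _ => integrable_finsetSum _ fun j _ => hi i j, Finset.mul_sum,
    Finset.mul_sum]
  refine Finset.sum_le_sum fun i _ => ?_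
  rw [integral_finsetSum _ fun j _ => hi i j, Finset.mul_sum, Finset.mul_sum]
  refine Finset.sum_le_sum fun j _ => ?_
  have := hG.covariance_exp_le (i + s) (j + s)
  rwa [add_sub_add_right_eq_sub] at this

/-- The integral over `[0, N]` is the average over shifts `s ∈ [0, 1]` of the sums over the points
`i + s`. By stationarity the second moments of these sums have a common bound, which the average
inherits. -/
lemma lintegral_sq_integral_le (hG : IsStationaryGaussianField G C P)
    (hcont : ∀ᵐ ω ∂P, Continuous fun x => G x ω) (N : ℕ) :
    AEMeasurable (fun ω => ∫ y in (0 : ℝ)..N, (Real.exp (-G y ω) - Real.exp (C 0 / 2))) P ∧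
      ∫⁻ ω, ENNReal.ofReal
        ((∫ y in (0 : ℝ)..N, (Real.exp (-G y ω) - Real.exp (C 0 / 2))) ^ 2) ∂P ≤
      ENNReal.ofReal (Real.exp (C 0) * (Real.exp (C 0) *
        ∑ i ∈ Finset.range N, ∑ j ∈ Finset.range N, |C ((i : ℝ) - j)|)) := by
  have hm : ∀ s : ℝ, AEMeasurable (fun ω =>
      ∑ i ∈ Finset.range N, (Real.exp (-G (i + s) ω) - Real.exp (C 0 / 2))) P := fun s =>
    Finset.aemeasurable_fun_sum _ fun i _ =>
      (Real.measurable_exp.comp_aemeasurable (hG.aemeasurable _).neg).sub_const _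
  have hc : ∀ᵐ ω ∂P, Continuous fun s : ℝ =>
      ∑ i ∈ Finset.range N, (Real.exp (-G (i + s) ω) - Real.exp (C 0 / 2)) := by
    filter_upwards [hcont] with ω hω
    refine continuous_finsetSum _ fun i _ => ?_
    exact (Real.continuous_exp.comp (hω.comp (continuous_const.add continuous_id)).neg).sub
      continuous_const
  have heq : (fun ω => ∫ s in (0 : ℝ)..1,
      ∑ i ∈ Finset.range N, (Real.exp (-G (i + s) ω) - Real.exp (C 0 / 2))) =ᵐ[P]
      fun ω => ∫ y in (0 : ℝ)..N, (Real.exp (-G y ω) - Real.exp (C 0 / 2)) := by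
    filter_upwards [hcont] with ω hω
    have hX : Continuous fun y => Real.exp (-G y ω) - Real.exp (C 0 / 2) :=
      (Real.continuous_exp.comp hω.neg).sub continuous_const
    have hXi : ∀ i : ℕ, Continuous fun s : ℝ => Real.exp (-G (i + s) ω) - Real.exp (C 0 / 2) :=
      fun i => hX.comp (continuous_const.add continuous_id)
    rw [intervalIntegral.integral_finsetSum fun i _ => (hXi i).intervalIntegrable _ _]
    have h1 := intervalIntegral.sum_integral_adjacent_intervals (a := fun i : ℕ => (i : ℝ))
      (μ := volume) (n := N) fun k _ => hX.intervalIntegrable _ _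
    rw [Nat.cast_zero] at h1
    rw [← h1]
    refine Finset.sum_congr rfl fun i _ => ?_
    rw [intervalIntegral.integral_comp_add_left
      (fun y => Real.exp (-G y ω) - Real.exp (C 0 / 2)) (i : ℝ)]
    simp
  obtain ⟨h1, h2⟩ := lintegral_sq_unitInterval_le hm hc (hG.lintegral_sum_sq_le N)
  refine ⟨h1.congr heq, le_trans (le_of_eq (lintegral_congr_ae ?_)) h2⟩
  filter_upwards [heq] with ω hω
  rw [hω]

/-- A quantitative law of large numbers along the sequence `n ^ (q + 4)`. -/
lemma ae_abs_integral_pow_le (hG : IsStationaryGaussianField G C P)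
    (hcont : ∀ᵐ ω ∂P, Continuous fun x => G x ω) {β : ℝ} (hβ : 0 < β)
    (hdecay : DecaysWithRate C β) {q : ℕ} (hq : 4 ≤ q * β) :
    ∀ᵐ ω ∂P, ∃ M : ℝ, 0 ≤ M ∧ ∀ n : ℕ,
      |∫ y in (0 : ℝ)..((n + 1) ^ (q + 4) : ℕ), (Real.exp (-G y ω) - Real.exp (C 0 / 2))| ≤
        M * ((n : ℝ) + 1) ^ (q + 3) := by
  obtain ⟨K, hK⟩ := hdecay
  have hK0 : 0 ≤ K := by simpa using (abs_nonneg _).trans (hK 0)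
  have hC0 := hG.covariance_zero_nonneg
  set D := Real.exp (C 0) * (Real.exp (C 0) * (2 * C 0 + K)) with hD
  have hD0 : 0 ≤ D := by positivity
  -- With `r = n + 1`, `N = r ^ (q + 4)` and `L = r ^ q`, both `N * L` and `N ^ 2 * L ^ (-β)` are at
  -- most `r ^ (2 * q + 4)`, the latter because `q * β ≥ 4`. Dividing by `r ^ (2 * q + 6)` leaves
  -- the summable `r ^ (-2)`, and the square root `r ^ (q + 3)` is still one power of `r` below `N`.
  let f : ℕ → Ω → ℝ := fun n ω => (((n : ℝ) + 1) ^ (2 * q + 6))⁻¹ *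
    (∫ y in (0 : ℝ)..((n + 1) ^ (q + 4) : ℕ), (Real.exp (-G y ω) - Real.exp (C 0 / 2))) ^ 2
  have hfm : ∀ n, AEMeasurable (f n) P := fun n =>
    ((hG.lintegral_sq_integral_le hcont _).1.pow_const 2).const_mul _
  have hfc : ∀ n, ∫⁻ ω, ENNReal.ofReal (f n ω) ∂P ≤
      ENNReal.ofReal (D * (((n : ℝ) + 1) ^ 2)⁻¹) := by
    intro n
    set r : ℝ := (n : ℝ) + 1 with hr
    have hr0 : 0 < r := by positivity
    have hw : 0 ≤ (r ^ (2 * q + 6))⁻¹ := by positivity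
    simp only [f]
    simp_rw [← hr, ENNReal.ofReal_mul hw]
    rw [lintegral_const_mul' _ _ ENNReal.ofReal_ne_top]
    refine (mul_le_mul_right (hG.lintegral_sq_integral_le hcont _).2 _).trans ?_
    rw [← ENNReal.ofReal_mul hw]
    refine ENNReal.ofReal_le_ofReal ?_
    have h1 := sum_sum_decay_le hβ hK0 hG.abs_covariance_le hK ((n + 1) ^ (q + 4))
      (L := (n + 1) ^ q) (by positivity)
    have h2 : (((n + 1) ^ q : ℕ) : ℝ) ^ (-β) ≤ (r ^ 4)⁻¹ := by
      push_cast
      rw [← hr, ← Real.rpow_natCast, ← Real.rpow_natCast, ← Real.rpow_mul hr0.le,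
        ← Real.rpow_neg hr0.le]
      refine Real.rpow_le_rpow_of_exponent_le (by rw [hr]; linarith [n.cast_nonneg (α := ℝ)]) ?_
      push_cast
      linarith
    have h3 : ∑ i ∈ Finset.range ((n + 1) ^ (q + 4)), ∑ j ∈ Finset.range ((n + 1) ^ (q + 4)),
        |C ((i : ℝ) - j)| ≤ (2 * C 0 + K) * r ^ (2 * q + 4) := by
      refine h1.trans ?_
      calc _ ≤ (((n + 1) ^ (q + 4) : ℕ) : ℝ) * (2 * ((n + 1) ^ q : ℕ) * C 0 +
            ((n + 1) ^ (q + 4) : ℕ) * (K * (r ^ 4)⁻¹)) := by gcongr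
        _ = (2 * C 0 + K) * r ^ (2 * q + 4) := by
          push_cast
          rw [← hr]
          field_simp
          ring
    calc _ ≤ (r ^ (2 * q + 6))⁻¹ * (Real.exp (C 0) * (Real.exp (C 0) *
          ((2 * C 0 + K) * r ^ (2 * q + 4)))) := by gcongr
      _ = D * (r ^ 2)⁻¹ := by
        rw [hD, show 2 * q + 6 = 2 * q + 4 + 2 by ring, pow_add r (2 * q + 4) 2]
        field_simp
  have hsum : Summable fun n : ℕ => D * (((n : ℝ) + 1) ^ 2)⁻¹ := by
    have := (summable_nat_add_iff 1).2 (Real.summable_nat_pow_inv (p := 2) |>.2 (by norm_num))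
    refine (this.congr fun n => ?_).mul_left D
    push_cast; rfl
  filter_upwards [ae_bounded_of_summable_lintegral hfm (fun n => by positivity) hsum hfc]
    with ω ⟨M, hM, hfM⟩
  refine ⟨√M, Real.sqrt_nonneg _, fun n => ?_⟩
  have h1 := hfM n
  simp only [f] at h1
  rw [inv_mul_le_iff₀ (by positivity)] at h1
  have h2 := Real.abs_le_sqrt h1
  rwa [Real.sqrt_mul (by positivity), show 2 * q + 6 = (q + 3) * 2 by ring, pow_mul,
    Real.sqrt_sq (by positivity), mul_comm] at h2

/-- A quantitative law of large numbers: the centred integral of `exp (-G)` over `[0, t]` grows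
slower than `t` by a power. -/
theorem ae_abs_integral_le (hG : IsStationaryGaussianField G C P)
    (hcont : ∀ᵐ ω ∂P, Continuous fun x => G x ω) {β : ℝ} (hβ : 0 < β)
    (hdecay : DecaysWithRate C β) :
    ∃ γ : ℝ, 0 < γ ∧ γ ≤ 1 ∧ ∀ᵐ ω ∂P, ∃ M : ℝ, 0 ≤ M ∧ ∀ t : ℝ, 0 ≤ t →
      |∫ y in (0 : ℝ)..t, (Real.exp (-G y ω) - Real.exp (C 0 / 2))| ≤ M * (1 + t) ^ (1 - γ) := by
  obtain ⟨q, hq⟩ := exists_nat_ge (4 / β)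
  rw [div_le_iff₀ hβ] at hq
  set m : ℕ := q + 4 with hm
  have hm0 : (0 : ℝ) < m := by rw [hm]; positivity
  have hm1 : (1 : ℝ) ≤ m := by rw [hm]; push_cast; linarith [q.cast_nonneg (α := ℝ)]
  refine ⟨1 / m, by positivity, by rw [div_le_one hm0]; exact hm1, ?_⟩
  filter_upwards [hcont, hG.ae_abs_integral_pow_le hcont hβ hdecay hq] with ω hω ⟨M, hM, hpow⟩
  set μ := Real.exp (C 0 / 2) with hμ
  have hμ0 : 0 < μ := Real.exp_pos _
  have hZ : Continuous fun y => Real.exp (-G y ω) := Real.continuous_exp.comp hω.neg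
  have hS : ∀ t : ℝ, ∫ y in (0 : ℝ)..t, (Real.exp (-G y ω) - μ) =
      (∫ y in (0 : ℝ)..t, Real.exp (-G y ω)) - μ * t := fun t => by
    rw [intervalIntegral.integral_sub (hZ.intervalIntegrable _ _) (by simp),
      intervalIntegral.integral_const, smul_eq_mul, sub_zero, mul_comm]
  -- Since `exp (-G)` is positive, its uncentred integral is monotone in time and can be sandwiched
  -- between consecutive sampling times.
  have hmono : ∀ a b : ℝ, a ≤ b →
      ∫ y in (0 : ℝ)..a, Real.exp (-G y ω) ≤ ∫ y in (0 : ℝ)..b, Real.exp (-G y ω) := by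
    intro a b hab
    rw [← intervalIntegral.integral_add_adjacent_intervals (hZ.intervalIntegrable 0 a)
      (hZ.intervalIntegrable a b)]
    have := intervalIntegral.integral_nonneg (μ := volume) (f := fun y => Real.exp (-G y ω)) hab
      fun y _ => (Real.exp_pos _).le
    linarith
  have hpow' : ∀ n : ℕ, |(∫ y in (0 : ℝ)..((n : ℝ) ^ m), Real.exp (-G y ω)) - μ * (n : ℝ) ^ m| ≤
      M * ((n : ℝ) + 1) ^ (q + 3) := by
    intro n
    rcases n with _ | n
    · simp [hm, hM]
    · have h1 := hpow n
      rw [hS, ← hm] at h1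
      push_cast at h1 ⊢
      refine h1.trans ?_
      gcongr
      linarith
  -- The inner power of two comes from `n + 2 ≤ 2 * (n + 1)` at the upper sampling time, `μ * m`
  -- from the gap between sampling times, and the outer power from `n + 1 ≤ 2 * (1 + t) ^ (1 / m)`.
  refine ⟨(M * 2 ^ (q + 3) + μ * m) * 2 ^ (q + 3), by positivity, fun t ht => ?_⟩
  set n := ⌊t ^ (1 / m : ℝ)⌋₊ with hn
  have htm : (t ^ (1 / m : ℝ)) ^ m = t := by
    rw [one_div, Real.rpow_inv_natCast_pow ht (by omega)]
  have hn1 : (n : ℝ) ≤ t ^ (1 / m : ℝ) := Nat.floor_le (by positivity)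
  have hn2 : t ^ (1 / m : ℝ) ≤ n + 1 := (Nat.lt_floor_add_one _).le
  have hnt : (n : ℝ) ^ m ≤ t := by
    rw [← htm]; exact pow_le_pow_left₀ (by positivity) hn1 m
  have htn : t ≤ ((n : ℝ) + 1) ^ m := by
    conv_lhs => rw [← htm]
    exact pow_le_pow_left₀ (by positivity) hn2 m
  have hgap : ((n : ℝ) + 1) ^ m - (n : ℝ) ^ m ≤ m * ((n : ℝ) + 1) ^ (q + 3) := by
    have := add_one_pow_sub_pow_le n (q + 3)
    rw [hm]; push_cast at this ⊢
    convert! this using 2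
    ring
  have hlow := (abs_le.1 (hpow' n)).1
  have hupp := (abs_le.1 (hpow' (n + 1))).2
  push_cast at hupp
  have hup2 : M * ((n : ℝ) + 1 + 1) ^ (q + 3) ≤ M * 2 ^ (q + 3) * ((n : ℝ) + 1) ^ (q + 3) := by
    rw [mul_assoc, ← mul_pow]
    gcongr
    linarith [n.cast_nonneg (α := ℝ)]
  have hlow2 : M * ((n : ℝ) + 1) ^ (q + 3) ≤ M * 2 ^ (q + 3) * ((n : ℝ) + 1) ^ (q + 3) := by
    have : (1 : ℝ) ≤ 2 ^ (q + 3) := one_le_pow₀ (by norm_num)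
    gcongr
    nlinarith
  have hA1 := hmono _ _ hnt
  have hA2 := hmono _ _ htn
  have hmain : |∫ y in (0 : ℝ)..t, (Real.exp (-G y ω) - μ)| ≤
      (M * 2 ^ (q + 3) + μ * m) * ((n : ℝ) + 1) ^ (q + 3) := by
    have hg := mul_le_mul_of_nonneg_left hgap hμ0.le
    have ht1 := mul_le_mul_of_nonneg_left hnt hμ0.le
    have ht2 := mul_le_mul_of_nonneg_left htn hμ0.le
    rw [hS, abs_le]
    constructor <;> linarith
  refine hmain.trans ?_
  rw [mul_assoc]
  refine mul_le_mul_of_nonneg_left ?_ (by positivity)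
  have h1t : t ^ (1 / m : ℝ) ≤ (1 + t) ^ (1 / m : ℝ) :=
    Real.rpow_le_rpow ht (by linarith) (by positivity)
  have h1t' : 1 ≤ (1 + t) ^ (1 / m : ℝ) := Real.one_le_rpow (by linarith) (by positivity)
  calc ((n : ℝ) + 1) ^ (q + 3) ≤ (2 * (1 + t) ^ (1 / m : ℝ)) ^ (q + 3) := by
        gcongr; linarith
    _ = 2 ^ (q + 3) * (1 + t) ^ (1 - 1 / m : ℝ) := by
        rw [mul_pow, ← Real.rpow_natCast ((1 + t) ^ (1 / m : ℝ)), ← Real.rpow_mul (by linarith)]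
        congr 2
        rw [hm]; push_cast; field_simp; ring

end IsStationaryGaussianField

/-! ### Explicit solution of the Dirichlet problem -/

section Dirichlet

lemma ContDiffOn.hasDerivAt_derivWithin_Icc {u : ℝ → ℝ} (hu : ContDiffOn ℝ 1 u (Icc 0 1))
    {x : ℝ} (hx : x ∈ Ioo (0 : ℝ) 1) : HasDerivAt u (derivWithin u (Icc 0 1) x) x :=
  ((hu.differentiableOn one_ne_zero) x (Ioo_subset_Icc_self hx)).hasDerivWithinAt.hasDerivAt
    (Icc_mem_nhds hx.1 hx.2)

lemma ContDiffOn.continuousOn_derivWithin_Icc {u : ℝ → ℝ} (hu : ContDiffOn ℝ 1 u (Icc 0 1)) :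
    ContinuousOn (derivWithin u (Icc 0 1)) (Icc 0 1) :=
  hu.continuousOn_derivWithin (uniqueDiffOn_Icc zero_lt_one) le_rfl

lemma ContDiffOn.integral_derivWithin_Icc {u : ℝ → ℝ} (hu : ContDiffOn ℝ 1 u (Icc 0 1))
    {x : ℝ} (hx : x ∈ Icc (0 : ℝ) 1) :
    ∫ y in (0 : ℝ)..x, derivWithin u (Icc 0 1) y = u x - u 0 := by
  have hsub : Icc 0 x ⊆ Icc (0 : ℝ) 1 := Icc_subset_Icc_right hx.2
  refine intervalIntegral.integral_eq_sub_of_hasDerivAt_of_le hx.1 (hu.continuousOn.mono hsub)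
    (fun y hy => hu.hasDerivAt_derivWithin_Icc ⟨hy.1, hy.2.trans_le hx.2⟩) ?_
  refine ContinuousOn.intervalIntegrable ?_
  rw [uIcc_of_le hx.1]
  exact hu.continuousOn_derivWithin_Icc.mono hsub

/-- The flux constant `c` in `A u' = f + c` for the Dirichlet problem `(A u')' = f'`. -/
noncomputable def fluxConstant (A f : ℝ → ℝ) : ℝ :=
  -(∫ x in (0 : ℝ)..1, f x * (A x)⁻¹) / ∫ x in (0 : ℝ)..1, (A x)⁻¹

variable {A f : ℝ → ℝ}

lemma integral_inv_pos (hA : Continuous A) (hpos : ∀ x, 0 < A x) :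
    0 < ∫ x in (0 : ℝ)..1, (A x)⁻¹ :=
  intervalIntegral.intervalIntegral_pos_of_pos
    ((hA.inv₀ fun x => (hpos x).ne').intervalIntegrable _ _) (fun x => inv_pos.2 (hpos x))
    zero_lt_one

lemma integral_mul_inv_add (hA : Continuous A) (hpos : ∀ x, 0 < A x)
    (hf : ContinuousOn f (Icc 0 1)) (c : ℝ) :
    ∫ x in (0 : ℝ)..1, (f x + c) * (A x)⁻¹ =
      (∫ x in (0 : ℝ)..1, f x * (A x)⁻¹) + c * ∫ x in (0 : ℝ)..1, (A x)⁻¹ := by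
  have hAi : Continuous fun x => (A x)⁻¹ := hA.inv₀ fun x => (hpos x).ne'
  have hfi : IntervalIntegrable (fun x => f x * (A x)⁻¹) volume 0 1 := by
    refine ContinuousOn.intervalIntegrable ?_
    rw [uIcc_of_le zero_le_one]
    exact hf.mul hAi.continuousOn
  simp_rw [add_mul]
  rw [intervalIntegral.integral_add hfi ((hAi.const_mul c).intervalIntegrable _ _),
    intervalIntegral.integral_const_mul]

/-- The function `A u' - f` has zero derivative inside and is continuous up to the endpoints, so it
is constant. Integrating `u'` over `[0, 1]` with the boundary values identifies the constant. -/
lemma IsSolution.derivWithin_eq (hA : Continuous A) (hpos : ∀ x, 0 < A x)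
    (hf : ContDiffOn ℝ 1 f (Icc 0 1)) {u : ℝ → ℝ} (hu : IsSolution A f u)
    {x : ℝ} (hx : x ∈ Icc (0 : ℝ) 1) :
    derivWithin u (Icc 0 1) x = (f x + fluxConstant A f) * (A x)⁻¹ := by
  set g : ℝ → ℝ := fun y => A y * derivWithin u (Icc 0 1) y - f y with hg
  have hgc : ContinuousOn g (Icc 0 1) :=
    (hA.continuousOn.mul hu.contDiffOn.continuousOn_derivWithin_Icc).sub hf.continuousOn
  have hgd : ∀ y ∈ Ioo (0 : ℝ) 1, HasDerivAt g 0 y := fun y hy => by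
    have h1 := (hu.equation y hy).sub (hf.hasDerivAt_derivWithin_Icc hy).differentiableAt.hasDerivAt
    rwa [sub_self] at h1
  have hconst : ∀ y ∈ Icc (0 : ℝ) 1, g y = g 0 := by
    intro y hy
    rcases eq_or_lt_of_le hy.1 with h | h
    · rw [← h]
    · obtain ⟨z, -, hz⟩ := exists_hasDerivAt_eq_slope g (fun _ => 0) h
        (hgc.mono (Icc_subset_Icc_right hy.2)) fun z hz => hgd z ⟨hz.1, hz.2.trans_le hy.2⟩
      rw [eq_comm, div_eq_zero_iff] at hz
      rcases hz with hz | hz <;> linarith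
  have hu' : ∀ y ∈ Icc (0 : ℝ) 1, derivWithin u (Icc 0 1) y = (f y + g 0) * (A y)⁻¹ := by
    intro y hy
    rw [← hconst y hy, hg]
    have := (hpos y).ne'
    field_simp
    ring
  have hint : (∫ x in (0 : ℝ)..1, f x * (A x)⁻¹) + g 0 * ∫ x in (0 : ℝ)..1, (A x)⁻¹ = 0 := by
    rw [← integral_mul_inv_add hA hpos hf.continuousOn]
    have h1 := hu.contDiffOn.integral_derivWithin_Icc (right_mem_Icc.2 zero_le_one)
    rw [hu.left, hu.right, sub_zero] at h1
    refine Eq.trans (intervalIntegral.integral_congr fun y hy => ?_) h1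
    rw [uIcc_of_le zero_le_one] at hy
    exact (hu' y hy).symm
  have hI := integral_inv_pos hA hpos
  have : g 0 = fluxConstant A f := by
    rw [fluxConstant, eq_div_iff hI.ne']
    linarith
  rw [hu' x hx, this]

/-- The primitive of `(f + c) / A` is a solution, with `c` chosen to meet the condition at `1`.
Uniqueness holds because the formula for the derivative involves the data alone. -/
theorem wellPosed_of_continuous (hA : Continuous A) (hpos : ∀ x, 0 < A x)
    (hf : ContDiffOn ℝ 1 f (Icc 0 1)) : WellPosed A f := by
  -- Nothing is known of `f` outside `[0, 1]`; the continuous extension makes the primitive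
  -- differentiable on the whole line.
  set F : ℝ → ℝ := IccExtend zero_le_one ((Icc (0 : ℝ) 1).domRestrict f) with hF
  have hFc : Continuous F := hf.continuousOn.domRestrict.Icc_extend'
  have hFf : ∀ x ∈ Icc (0 : ℝ) 1, F x = f x := fun x hx => by
    rw [hF, IccExtend_of_mem _ _ hx]; rfl
  set c := fluxConstant A f with hc
  set w : ℝ → ℝ := fun x => (F x + c) * (A x)⁻¹ with hw
  have hwc : Continuous w := (hFc.add continuous_const).mul (hA.inv₀ fun x => (hpos x).ne')
  set u : ℝ → ℝ := fun x => ∫ y in (0 : ℝ)..x, w y with hu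
  have hud : ∀ x, HasDerivAt u (w x) x := fun x =>
    hwc.integral_hasStrictDerivAt 0 x |>.hasDerivAt
  have hderiv : deriv u = w := funext fun x => (hud x).deriv
  have hu' : ∀ x ∈ Icc (0 : ℝ) 1, derivWithin u (Icc 0 1) x = w x := fun x hx =>
    (hud x).hasDerivWithinAt.derivWithin (uniqueDiffOn_Icc zero_lt_one x hx)
  have hsol : IsSolution A f u := by
    refine ⟨?_, fun x hx => ?_, ?_, ?_⟩
    · exact (contDiff_one_iff_deriv.2
        ⟨fun x => (hud x).differentiableAt, by rwa [hderiv]⟩).contDiffOn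
    · have h1 : HasDerivAt (fun y => f y + c) (deriv f x) x :=
        ((hf.hasDerivAt_derivWithin_Icc hx).differentiableAt.hasDerivAt).add_const c
      refine h1.congr_of_eventuallyEq ?_
      filter_upwards [Icc_mem_nhds hx.1 hx.2] with y hy
      rw [hu' y hy, hw]
      simp only
      rw [hFf y hy]
      have := (hpos y).ne'
      field_simp
    · simp [hu]
    · have h1 : ∫ y in (0 : ℝ)..1, w y = ∫ y in (0 : ℝ)..1, (f y + c) * (A y)⁻¹ := by
        refine intervalIntegral.integral_congr fun y hy => ?_
        rw [uIcc_of_le zero_le_one] at hy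
        simp only [hw]
        rw [hFf y hy]
      simp only [hu]
      rw [h1, integral_mul_inv_add hA hpos hf.continuousOn, hc, fluxConstant]
      have hI := (integral_inv_pos hA hpos).ne'
      rw [div_mul_cancel₀ _ hI, add_neg_cancel]
  refine ⟨u, hsol, fun v hv x hx => ?_⟩
  have h1 := hv.contDiffOn.integral_derivWithin_Icc hx
  have h2 := hsol.contDiffOn.integral_derivWithin_Icc hx
  rw [hv.left, sub_zero] at h1
  rw [hsol.left, sub_zero] at h2
  rw [← h1, ← h2]
  refine intervalIntegral.integral_congr fun y hy => ?_
  rw [uIcc_of_le hx.1] at hy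
  have hy' : y ∈ Icc (0 : ℝ) 1 := ⟨hy.1, hy.2.trans hx.2⟩
  rw [hv.derivWithin_eq hA hpos hf hy', hsol.derivWithin_eq hA hpos hf hy']

/-- Integrals against a `C¹` weight are controlled by the primitive of the integrand. -/
lemma exists_abs_integral_mul_le (hf : ContDiffOn ℝ 1 f (Icc 0 1)) :
    ∃ L : ℝ, 0 ≤ L ∧ ∀ (X : ℝ → ℝ) (b : ℝ), Continuous X →
      (∀ x ∈ Icc (0 : ℝ) 1, |∫ y in (0 : ℝ)..x, X y| ≤ b) →
      |∫ x in (0 : ℝ)..1, f x * X x| ≤ L * b := by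
  obtain ⟨D, hD⟩ := isCompact_Icc.exists_bound_of_continuousOn hf.continuousOn_derivWithin_Icc
  have hD0 : 0 ≤ D := (norm_nonneg _).trans (hD 0 (left_mem_Icc.2 zero_le_one))
  -- Integration by parts against the primitive `W`, with `W 0 = 0`: the boundary term costs `|f 1|`
  -- and the remaining integral costs the bound `D` on `f'`.
  refine ⟨|f 1| + D, by positivity, fun X b hX hb => ?_⟩
  have hb0 : 0 ≤ b := (abs_nonneg _).trans (hb 0 (left_mem_Icc.2 zero_le_one))
  set W : ℝ → ℝ := fun x => ∫ y in (0 : ℝ)..x, X y with hW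
  have hWd : ∀ x, HasDerivAt W (X x) x := fun x => (hX.integral_hasStrictDerivAt 0 x).hasDerivAt
  have hf'i : IntervalIntegrable (derivWithin f (Icc 0 1)) volume 0 1 := by
    refine ContinuousOn.intervalIntegrable ?_
    rw [uIcc_of_le zero_le_one]
    exact hf.continuousOn_derivWithin_Icc
  have hparts := intervalIntegral.integral_mul_deriv_eq_deriv_mul_of_hasDerivAt
    (u := f) (v := W) (u' := derivWithin f (Icc 0 1)) (v' := X) (a := 0) (b := 1)
    (by rw [uIcc_of_le zero_le_one]; exact hf.continuousOn)
    (fun x _ => (hWd x).continuousAt.continuousWithinAt)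
    (fun x hx => hf.hasDerivAt_derivWithin_Icc (by simpa using hx)) (fun x _ => hWd x) hf'i
    (hX.intervalIntegrable _ _)
  have hW0 : W 0 = 0 := by simp [hW]
  rw [hW0, mul_zero, sub_zero] at hparts
  have h1 : ‖∫ x in (0 : ℝ)..1, derivWithin f (Icc 0 1) x * W x‖ ≤ D * b * |(1 : ℝ) - 0| := by
    refine intervalIntegral.norm_integral_le_of_norm_le_const fun x hx => ?_
    rw [uIoc_of_le zero_le_one] at hx
    have hx' : x ∈ Icc (0 : ℝ) 1 := ⟨hx.1.le, hx.2⟩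
    rw [norm_mul]
    exact mul_le_mul (hD x hx') (hb x hx') (norm_nonneg _) hD0
  rw [Real.norm_eq_abs, sub_zero, abs_one, mul_one] at h1
  have h2 : |f 1 * W 1| ≤ |f 1| * b := by
    rw [abs_mul]
    exact mul_le_mul_of_nonneg_left (hb 1 (right_mem_Icc.2 zero_le_one)) (abs_nonneg _)
  rw [hparts, add_mul]
  exact (abs_sub _ _).trans (add_le_add h2 h1)

end Dirichlet

/-! ### Rate for the flux constant and conclusion -/

section Homogenization

variable {f : ℝ → ℝ}

/-- A deterministic homogenization estimate: if `Z` averages to `μ` with an algebraic rate, the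
flux constant of the oscillating problem converges with the same rate. -/
lemma exists_abs_fluxConstant_sub_le (hf : ContDiffOn ℝ 1 f (Icc 0 1)) {Z : ℝ → ℝ}
    (hZ : Continuous Z) {μ γ M : ℝ} (hμ : 0 < μ) (hγ : 0 < γ) (hγ1 : γ ≤ 1) (hM : 0 ≤ M)
    (hS : ∀ t : ℝ, 0 ≤ t → |∫ y in (0 : ℝ)..t, (Z y - μ)| ≤ M * (1 + t) ^ (1 - γ)) :
    ∃ Q : ℝ, 0 ≤ Q ∧ ∀ᶠ ε in 𝓝[>] (0 : ℝ),
      |-(∫ x in (0 : ℝ)..1, f x * Z (x / ε)) / (∫ x in (0 : ℝ)..1, Z (x / ε))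
        - -(∫ x in (0 : ℝ)..1, f x)| ≤ Q * ε ^ γ := by
  obtain ⟨L, hL, hLX⟩ := exists_abs_integral_mul_le hf
  set m := ∫ x in (0 : ℝ)..1, f x with hm
  -- The numerator of the error is at most `(L + |m|) * (2 * M * ε ^ γ)`, and for small `ε` the
  -- denominator stays above `μ / 2`.
  refine ⟨(L + |m|) * (2 * M) / (μ / 2), by positivity, ?_⟩
  have hsmall : ∀ᶠ ε in 𝓝[>] (0 : ℝ), 2 * M * ε ^ γ < μ / 2 := by
    have h1 : Tendsto (fun ε : ℝ => 2 * M * ε ^ γ) (𝓝[>] 0) (𝓝 0) := by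
      have h2 : Tendsto (fun ε : ℝ => ε ^ γ) (𝓝 0) (𝓝 0) := by
        have := (Real.continuousAt_rpow_const 0 γ (Or.inr hγ.le)).tendsto
        rwa [Real.zero_rpow hγ.ne'] at this
      simpa using (h2.mono_left nhdsWithin_le_nhds).const_mul (2 * M)
    exact h1.eventually (gt_mem_nhds (by positivity))
  filter_upwards [hsmall, Ioc_mem_nhdsGT zero_lt_one] with ε hεs hε
  have hε0 : 0 < ε := hε.1
  have hZε : Continuous fun x => Z (x / ε) := hZ.comp (continuous_id.div_const ε)
  set b := 2 * M * ε ^ γ with hb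
  have hb0 : 0 ≤ b := by positivity
  -- Rescaling turns the bound at time `x / ε` into `ε * M * (2 / ε) ^ (1 - γ)`, using `ε ≤ 1`.
  have hW : ∀ x ∈ Icc (0 : ℝ) 1, |∫ y in (0 : ℝ)..x, (Z (y / ε) - μ)| ≤ b := by
    intro x hx
    rw [intervalIntegral.integral_comp_div (fun y => Z y - μ) hε0.ne', zero_div, smul_eq_mul,
      abs_mul, abs_of_pos hε0]
    have h1 := hS (x / ε) (div_nonneg hx.1 hε0.le)
    have h2 : 1 + x / ε ≤ 2 / ε := by
      rw [le_div_iff₀ hε0, add_mul, div_mul_cancel₀ _ hε0.ne']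
      linarith [hx.2, hε.2]
    have h3 : (1 + x / ε) ^ (1 - γ) ≤ 2 * (ε ^ γ / ε) := by
      calc (1 + x / ε) ^ (1 - γ) ≤ (2 / ε) ^ (1 - γ) :=
            Real.rpow_le_rpow (by have := div_nonneg hx.1 hε0.le; linarith) h2 (by linarith)
        _ = 2 ^ (1 - γ) * (ε ^ γ / ε) := by
            rw [Real.div_rpow (by norm_num) hε0.le, Real.rpow_sub hε0, Real.rpow_one]
            field_simp
        _ ≤ 2 * (ε ^ γ / ε) := by
            refine mul_le_mul_of_nonneg_right ?_ (by positivity)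
            calc (2 : ℝ) ^ (1 - γ) ≤ 2 ^ (1 : ℝ) :=
                  Real.rpow_le_rpow_of_exponent_le (by norm_num) (by linarith)
              _ = 2 := Real.rpow_one 2
    calc ε * _ ≤ ε * (M * (2 * (ε ^ γ / ε))) := by gcongr; exact h1.trans (by gcongr)
      _ = b := by rw [hb]; field_simp
  have hfi : IntervalIntegrable f volume 0 1 := by
    refine ContinuousOn.intervalIntegrable ?_
    rw [uIcc_of_le zero_le_one]; exact hf.continuousOn
  set I := ∫ x in (0 : ℝ)..1, Z (x / ε) with hI
  set J := ∫ x in (0 : ℝ)..1, f x * Z (x / ε) with hJ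
  have hIb : |I - μ| ≤ b := by
    have h1 := hW 1 (right_mem_Icc.2 zero_le_one)
    rw [intervalIntegral.integral_sub (hZε.intervalIntegrable _ _) (by simp),
      intervalIntegral.integral_const] at h1
    simpa using h1
  have hJb : |J - μ * m| ≤ L * b := by
    have h1 := hLX (fun x => Z (x / ε) - μ) b (hZε.sub continuous_const) hW
    have h2 : ∫ x in (0 : ℝ)..1, f x * (Z (x / ε) - μ) = J - μ * m := by
      simp_rw [mul_sub]
      rw [intervalIntegral.integral_sub (hfi.mul_continuousOn hZε.continuousOn)
        (hfi.mul_const μ), intervalIntegral.integral_mul_const, mul_comm μ]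
    rwa [h2] at h1
  have hIpos : μ / 2 ≤ I := by linarith [(abs_le.1 hIb).1]
  have hI0 : 0 < I := lt_of_lt_of_le (by positivity) hIpos
  have e : -J / I - -m = ((I - μ) * m - (J - μ * m)) / I := by field_simp; ring
  rw [e, abs_div, abs_of_pos hI0]
  have hnum : |(I - μ) * m - (J - μ * m)| ≤ (L + |m|) * b := by
    refine (abs_sub _ _).trans ?_
    rw [abs_mul]
    have := mul_le_mul_of_nonneg_right hIb (abs_nonneg m)
    linarith
  calc _ ≤ (L + |m|) * b / (μ / 2) := by gcongr
    _ = _ := by rw [hb]; ring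

lemma fluxConstant_const {a : ℝ} (ha : a ≠ 0) (f : ℝ → ℝ) :
    fluxConstant (fun _ => a) f = -∫ x in (0 : ℝ)..1, f x := by
  rw [fluxConstant, intervalIntegral.integral_mul_const]
  simp only [intervalIntegral.integral_const, sub_zero, one_smul]
  field_simp

/-- Convergence of the two-scale expansion for a fixed coefficient field, given the averaging
rate of `exp (-h)` and its subpolynomial growth. -/
theorem tendsto_derivWithin_sub (hf : ContDiffOn ℝ 1 f (Icc 0 1)) {h : ℝ → ℝ}
    (hh : Continuous h) {κ γ M M' : ℝ} (hγ : 0 < γ) (hγ1 : γ ≤ 1) (hM : 0 ≤ M) (hM' : 0 ≤ M')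
    (hS : ∀ t : ℝ, 0 ≤ t →
      |∫ y in (0 : ℝ)..t, (Real.exp (-h y) - Real.exp κ)| ≤ M * (1 + t) ^ (1 - γ))
    (hgrowth : ∀ x, Real.exp (-h x) ≤ M' * (2 + |x|) ^ (γ / 2))
    {u : ℝ → ℝ → ℝ} {ubar : ℝ → ℝ}
    (hu : ∀ ε : ℝ, 0 < ε → IsSolution (fun x => Real.exp (h (x / ε))) f (u ε))
    (hubar : IsSolution (fun _ => Real.exp (-κ)) f ubar) {x : ℝ} (hx : x ∈ Icc (0 : ℝ) 1) :
    Tendsto (fun ε : ℝ => derivWithin (u ε) (Icc 0 1) x -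
      derivWithin ubar (Icc 0 1) x * (Real.exp (-κ) / Real.exp (h (x / ε)))) (𝓝[>] 0) (𝓝 0) := by
  obtain ⟨Q, hQ, hrate⟩ := exists_abs_fluxConstant_sub_le hf
    (Z := fun y => Real.exp (-h y)) (Real.continuous_exp.comp hh.neg) (Real.exp_pos κ) hγ hγ1 hM hS
  have hlim : Tendsto (fun ε : ℝ => 3 * Q * M' * ε ^ (γ / 2)) (𝓝[>] 0) (𝓝 0) := by
    have h2 : Tendsto (fun ε : ℝ => ε ^ (γ / 2)) (𝓝 0) (𝓝 0) := by
      have := (Real.continuousAt_rpow_const 0 (γ / 2) (Or.inr (by positivity))).tendsto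
      rwa [Real.zero_rpow (by positivity)] at this
    simpa using (h2.mono_left nhdsWithin_le_nhds).const_mul (3 * Q * M')
  refine squeeze_zero_norm' ?_ hlim
  filter_upwards [hrate, Ioc_mem_nhdsGT zero_lt_one] with ε hr hε
  have hε0 : 0 < ε := hε.1
  have hA : Continuous fun x => Real.exp (h (x / ε)) :=
    Real.continuous_exp.comp (hh.comp (continuous_id.div_const ε))
  rw [(hu ε hε0).derivWithin_eq hA (fun y => Real.exp_pos _) hf hx,
    hubar.derivWithin_eq continuous_const (fun y => Real.exp_pos _) hf hx,
    fluxConstant_const (Real.exp_pos _).ne']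
  have hflux : fluxConstant (fun x => Real.exp (h (x / ε))) f =
      -(∫ x in (0 : ℝ)..1, f x * Real.exp (-h (x / ε))) /
        (∫ x in (0 : ℝ)..1, Real.exp (-h (x / ε))) := by
    simp_rw [fluxConstant, Real.exp_neg]
  rw [hflux]
  set c := -(∫ x in (0 : ℝ)..1, f x * Real.exp (-h (x / ε))) /
        (∫ x in (0 : ℝ)..1, Real.exp (-h (x / ε)))
  set m := ∫ x in (0 : ℝ)..1, f x
  -- The contributions of `f x` cancel: the error is the flux error times `exp (-h (x / ε))`.
  have e : (f x + c) * (Real.exp (h (x / ε)))⁻¹ -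
      (f x + -m) * (Real.exp (-κ))⁻¹ * (Real.exp (-κ) / Real.exp (h (x / ε))) =
      (c - -m) * Real.exp (-h (x / ε)) := by
    rw [Real.exp_neg (h (x / ε))]
    have := (Real.exp_pos (-κ)).ne'
    field_simp
    ring
  rw [e, norm_mul, Real.norm_eq_abs, Real.norm_eq_abs, abs_of_pos (Real.exp_pos _)]
  have hg : Real.exp (-h (x / ε)) ≤ M' * (3 / ε ^ (γ / 2)) := by
    refine (hgrowth (x / ε)).trans (mul_le_mul_of_nonneg_left ?_ hM')
    have h0 := div_nonneg hx.1 hε0.le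
    rw [abs_of_nonneg h0]
    calc (2 + x / ε) ^ (γ / 2) ≤ (3 / ε) ^ (γ / 2) := by
          refine Real.rpow_le_rpow (by positivity) ?_ (by positivity)
          rw [le_div_iff₀ hε0, add_mul, div_mul_cancel₀ _ hε0.ne']
          linarith [hx.2, hε.2]
      _ = 3 ^ (γ / 2) / ε ^ (γ / 2) := Real.div_rpow (by norm_num) hε0.le _
      _ ≤ 3 / ε ^ (γ / 2) := by
          gcongr
          calc (3 : ℝ) ^ (γ / 2) ≤ 3 ^ (1 : ℝ) :=
                Real.rpow_le_rpow_of_exponent_le (by norm_num) (by linarith)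
            _ = 3 := Real.rpow_one 3
  calc _ ≤ Q * ε ^ γ * (M' * (3 / ε ^ (γ / 2))) :=
        mul_le_mul hr hg (Real.exp_pos _).le (by positivity)
    _ = 3 * Q * M' * ε ^ (γ / 2) := by
        have : ε ^ γ = ε ^ (γ / 2) * ε ^ (γ / 2) := by rw [← Real.rpow_add hε0]; ring_nf
        rw [this]
        have : ε ^ (γ / 2) ≠ 0 := by positivity
        field_simp

end Homogenization

theorem theorem0 {Ω : Type*} [MeasurableSpace Ω] (P : Measure Ω) [IsProbabilityMeasure P]
    (G : ℝ → Ω → ℝ) (C : ℝ → ℝ) (β : ℝ) (hβ : 0 < β)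
    (hG : IsStationaryGaussianField G C P)
    (hHolder : HolderAtZero C) (hdecay : DecaysWithRate C β)
    (f : ℝ → ℝ) (hf : ContDiffOn ℝ 1 f (Icc 0 1)) :
    -- the field has a continuous modification
    (∃ H : ℝ → Ω → ℝ, IsContinuousModification H G P) ∧
    -- the effective problem is well-posed
    WellPosed (fun _ => Real.exp (-(C 0 / 2))) f ∧
    ∀ H : ℝ → Ω → ℝ, IsContinuousModification H G P →
      ∀ᵐ ω ∂P,
        (∀ ε : ℝ, 0 < ε → WellPosed (fun x => Real.exp (H (x / ε) ω)) f) ∧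
        ∀ (u : ℝ → ℝ → ℝ) (ubar : ℝ → ℝ),
          (∀ ε : ℝ, 0 < ε → IsSolution (fun x => Real.exp (H (x / ε) ω)) f (u ε)) →
          IsSolution (fun _ => Real.exp (-(C 0 / 2))) f ubar →
          ∀ x ∈ Icc (0 : ℝ) 1,
            Tendsto
              (fun ε : ℝ => derivWithin (u ε) (Icc 0 1) x -
                derivWithin ubar (Icc 0 1) x *
                  (Real.exp (-(C 0 / 2)) / Real.exp (H (x / ε) ω)))
              (𝓝[>] 0) (𝓝 0) := by
  refine ⟨hG.exists_continuousModification hHolder,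
    wellPosed_of_continuous continuous_const (fun _ => Real.exp_pos _) hf, fun H hH => ?_⟩
  -- Any continuous modification is again a stationary Gaussian field with covariance `C`, so the
  -- almost sure estimates apply directly to `H`.
  have hHG := hG.congr hH.modification
  obtain ⟨γ, hγ, hγ1, hS⟩ := hHG.ae_abs_integral_le hH.continuous hβ hdecay
  filter_upwards [hH.continuous, hS,
    hHG.ae_exp_neg_le hHolder hH.continuous (half_pos hγ)]
    with ω hω ⟨M, hM, hSω⟩ ⟨M', hM', hgrowth⟩
  refine ⟨fun ε _ => wellPosed_of_continuous
    (Real.continuous_exp.comp (hω.comp (continuous_id.div_const ε))) (fun _ => Real.exp_pos _) hf,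
    fun u ubar hu hubar x hx => ?_⟩
  exact tendsto_derivWithin_sub hf hω hγ hγ1 hM hM' hSω hgrowth hu hubar hx
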